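/- Let $\mathbb{T}=\mathbb{R}/2\pi\mathbb{Z}$, let $\mathbb{F}\in\{\mathbb{R},\mathbb{C}\}$, and let $L^2=L^2(\mathbb{R}_x\times\mathbb{T}_y;\mathbb{F})$ with respect to $dx\,dy$. For $u\in L^2$ let $\hat u(\xi,n)$, $(\xi,n)\in\mathbb{R}\times\mathbb{Z}$, denote its Fourier transform in $(x,y)$, and let $\partial_x$ and $\partial_x^{-1}\partial_y$ be the Fourier multipliers with symbols $i\xi$ and $(i\xi)^{-1}(in)=n/\xi$. Let $$\mathcal{E}=\{u\in L^2:\ \partial_xu\in L^2,\ \partial_x^{-1}\partial_yu\in L^2\},\qquad \|u\|_{\mathcal{E}}^2=\|u\|_{L^2}^2+\|\partial_xu\|_{L^2}^2+\|\partial_x^{-1}\partial_yu\|_{L^2}^2 .$$ For $c>0$ let $$Q_c(x)=\sqrt{\tfrac c2}\,\tanh\Big(\sqrt{\tfrac c2}\,x\Big),\qquad \varphi_c(x)=c\cosh^{-2}\Big(\sqrt{\tfrac c2}\,x\Big),$$ regarded as functions on $\mathbb{R}\times\mathbb{T}$ that do not depend on $y$, and consider $$\mathcal{L}_c=-\partial_x+\partial_x^{-1}\partial_y-2Q_c(x)$$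 as a bounded operator from $\mathcal{E}$ to $L^2$. **Lemma.** For every $c>0$ the operator $\mathcal{L}_c:\mathcal{E}\to L^2$ is Fredholm. More precisely: 1. $\ker(\mathcal{L}_c)=\operatorname{span}_{\mathbb{F}}\{\varphi_c\}$; 2. $\operatorname{Range}(\mathcal{L}_c)=L^2$; 3. the restriction $\mathcal{L}_c:\mathcal{E}\cap(Q_c')^\perp\to L^2$ is bijective with bounded inverse, where $\mathcal{E}\cap(Q_c')^\perp=\{u\in\mathcal{E}:\int_{\mathbb{R}\times\mathbb{T}}u\,Q_c'\,dx\,dy=0\}$ carries the norm of $\mathcal{E}$. -/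

import Mathlib

open MeasureTheory FourierTransform
open scoped ENNReal

noncomputable section

namespace LineSoliton

instance instFactTwoPiPos : Fact (0 < 2 * Real.pi) := ⟨Real.two_pi_pos⟩

/-- The one-dimensional torus `ℝ / 2πℤ`. -/
abbrev Torus : Type := AddCircle (2 * Real.pi)

/-- `L²(ℝ × 𝕋)` for `dx dy`, where `dy` has total mass `2π`; real-valued for `𝕜 = ℝ`,
complex-valued for `𝕜 = ℂ`. -/
abbrev L2 (𝕜 : Type*) [RCLike 𝕜] := Lp 𝕜 2 (volume : Measure (ℝ × Torus))

section Fourier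

variable {𝕜 : Type*} [RCLike 𝕜]

theorem norm_map_complex (z : 𝕜) : ‖RCLike.map 𝕜 ℂ z‖ = ‖z‖ := by
  rw [← sq_eq_sq₀ (norm_nonneg _) (norm_nonneg _), ← RCLike.normSq_eq_def', ← RCLike.normSq_eq_def',
    RCLike.normSq_apply, RCLike.normSq_apply]
  simp

theorem map_complex_mul (a b : 𝕜) :
    RCLike.map 𝕜 ℂ (a * b) = RCLike.map 𝕜 ℂ a * RCLike.map 𝕜 ℂ b := by
  apply Complex.ext <;> simp

theorem volume_eq_smul_prod : (volume : Measure (ℝ × Torus)) =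
    ENNReal.ofReal (2 * Real.pi) •
      ((volume : Measure ℝ).prod (AddCircle.haarAddCircle : Measure Torus)) := by
  rw [Measure.volume_eq_prod, AddCircle.volume_eq_smul_haarAddCircle, Measure.prod_smul_right]

theorem prod_absolutelyContinuous :
    ((volume : Measure ℝ).prod (AddCircle.haarAddCircle : Measure Torus)) ≪
      (volume : Measure (ℝ × Torus)) := by
  rw [volume_eq_smul_prod]
  refine Measure.absolutelyContinuous_smul ?_
  simp [Real.pi_pos]

theorem memLp_prod_haar {f : ℝ × Torus → ℂ} (hf : MemLp f 2 volume) :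
    MemLp f 2 ((volume : Measure ℝ).prod (AddCircle.haarAddCircle : Measure Torus)) := by
  rw [volume_eq_smul_prod] at hf
  have h := hf.smul_measure (c := (ENNReal.ofReal (2 * Real.pi))⁻¹)
    (by simp [Real.pi_pos])
  rwa [smul_smul, ENNReal.inv_mul_cancel (by simp [Real.pi_pos]) (by finiteness), one_smul] at h

/-- An element of `L²(ℝ × 𝕋)` as a complex-valued function. -/
def toComplexFun (u : L2 𝕜) (p : ℝ × Torus) : ℂ := RCLike.map 𝕜 ℂ (u p)

theorem memLp_toComplexFun (u : L2 𝕜) : MemLp (toComplexFun u) 2 volume := by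
  refine (Lp.memLp u).of_le ?_ ?_
  · exact (RCLike.map 𝕜 ℂ).continuous.comp_aestronglyMeasurable (Lp.aestronglyMeasurable u)
  · exact Filter.Eventually.of_forall fun p => (norm_map_complex _).le

/-- The coefficient `u_n(x) = (1/2π) ∫_𝕋 u(x,y) e^{-iny} dy` of the Fourier series in `y`. -/
def modeFun (u : L2 𝕜) (n : ℤ) (x : ℝ) : ℂ :=
  fourierCoeff (fun y : Torus => toComplexFun u (x, y)) n

theorem memLp_modeFun (u : L2 𝕜) (n : ℤ) : MemLp (modeFun u n) 2 volume := by
  have hu := memLp_prod_haar (memLp_toComplexFun u)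
  have hmeas : AEStronglyMeasurable
      (fun p : ℝ × Torus => fourier (-n) p.2 • toComplexFun u p)
      ((volume : Measure ℝ).prod (AddCircle.haarAddCircle : Measure Torus)) :=
    AEStronglyMeasurable.smul
      (((map_continuous (fourier (-n))).comp continuous_snd).aestronglyMeasurable)
      hu.aestronglyMeasurable
  refine ⟨hmeas.integral_prod_right', ?_⟩
  have hfin := (lintegral_rpow_enorm_lt_top_of_eLpNorm_lt_top two_ne_zero ENNReal.ofNat_ne_top hu.2)
  refine (eLpNorm_lt_top_iff_lintegral_rpow_enorm_lt_top two_ne_zero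
    ENNReal.ofNat_ne_top).2 (lt_of_le_of_lt ?_ hfin)
  rw [lintegral_prod _ (hu.aestronglyMeasurable.enorm.pow_const _)]
  refine lintegral_mono_ae ?_
  filter_upwards [hu.aestronglyMeasurable.prodMk_left] with x hx
  have h1 : ‖modeFun u n x‖ₑ ≤ eLpNorm (fun y : Torus => toComplexFun u (x, y)) 2
      AddCircle.haarAddCircle := by
    refine le_trans ?_ (eLpNorm_le_eLpNorm_of_exponent_le (p := 1) (by norm_num) hx)
    rw [eLpNorm_one_eq_lintegral_enorm]
    refine (enorm_integral_le_lintegral_enorm _).trans (lintegral_mono fun y => ?_)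
    rw [enorm_smul]
    have : ‖fourier (-n) y‖ₑ = 1 := by
      rw [← ofReal_norm, fourier_apply, Circle.norm_coe]; simp
    rw [this, one_mul]
  rw [eLpNorm_eq_lintegral_rpow_enorm_toReal two_ne_zero ENNReal.ofNat_ne_top] at h1
  calc _ ≤ _ := ENNReal.rpow_le_rpow h1 (by norm_num)
    _ = _ := by rw [← ENNReal.rpow_mul]; simp

/-- The coefficient `u_n` as an element of `L²(ℝ)`. -/
def mode (u : L2 𝕜) (n : ℤ) : Lp ℂ 2 (volume : Measure ℝ) := (memLp_modeFun u n).toLp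

theorem toComplexFun_section_integrable (u : L2 𝕜) : ∀ᵐ x : ℝ,
    MemLp (fun y : Torus => toComplexFun u (x, y)) 2 AddCircle.haarAddCircle := by
  have hu := memLp_prod_haar (memLp_toComplexFun u)
  have hfin := (lintegral_rpow_enorm_lt_top_of_eLpNorm_lt_top two_ne_zero ENNReal.ofNat_ne_top hu.2)
  rw [lintegral_prod _ (hu.aestronglyMeasurable.enorm.pow_const _)] at hfin
  filter_upwards [hu.aestronglyMeasurable.prodMk_left,
    ae_lt_top' ((hu.aestronglyMeasurable.enorm.pow_const _).lintegral_prod_right') hfin.ne]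
    with x hx hx2
  exact ⟨hx, (eLpNorm_lt_top_iff_lintegral_rpow_enorm_lt_top two_ne_zero
    ENNReal.ofNat_ne_top).2 hx2⟩

theorem ae_section_of_ae {P : ℝ × Torus → Prop} (h : ∀ᵐ p, P p) :
    ∀ᵐ x : ℝ, ∀ᵐ y ∂(AddCircle.haarAddCircle : Measure Torus), P (x, y) :=
  Measure.ae_ae_of_ae_prod (prod_absolutelyContinuous.ae_le h)

theorem mode_add (u v : L2 𝕜) (n : ℤ) : mode (u + v) n = mode u n + mode v n := by
  rw [mode, mode, mode, ← MemLp.toLp_add]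
  refine MemLp.toLp_congr _ _ ?_
  filter_upwards [toComplexFun_section_integrable u, toComplexFun_section_integrable v,
    ae_section_of_ae (Lp.coeFn_add u v)] with x hu hv hx
  rw [Pi.add_apply, modeFun, modeFun, modeFun, ← Pi.add_apply,
    ← fourierCoeff.add (hu.integrable one_le_two) (hv.integrable one_le_two)]
  refine congrFun (fourierCoeff_congr_ae ?_) n
  filter_upwards [hx] with y hy
  simp only [toComplexFun, Pi.add_apply] at hy ⊢
  rw [hy, map_add]

theorem mode_smul (a : 𝕜) (u : L2 𝕜) (n : ℤ) :
    mode (a • u) n = RCLike.map 𝕜 ℂ a • mode u n := by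
  rw [mode, mode, ← MemLp.toLp_const_smul]
  refine MemLp.toLp_congr _ _ ?_
  filter_upwards [ae_section_of_ae (Lp.coeFn_smul a u)] with x hx
  rw [Pi.smul_apply, modeFun, modeFun, ← fourierCoeff.const_smul]
  refine congrFun (fourierCoeff_congr_ae ?_) n
  filter_upwards [hx] with y hy
  simp only [toComplexFun, Pi.smul_apply, smul_eq_mul] at hy ⊢
  rw [hy, map_complex_mul]

theorem eq_zero_of_mode_eq_zero (u : L2 𝕜) (h : ∀ n, mode u n = 0) : u = 0 := by
  have h1 : ∀ᵐ x : ℝ, ∀ n, modeFun u n x = 0 := by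
    rw [ae_all_iff]
    intro n
    have := (memLp_modeFun u n).coeFn_toLp
    have h0 := Lp.coeFn_zero ℂ 2 (volume : Measure ℝ)
    rw [← h n] at h0
    exact this.symm.trans h0
  have h2 : ∀ᵐ x : ℝ, ∀ᵐ y ∂(AddCircle.haarAddCircle : Measure Torus), u (x, y) = 0 := by
    filter_upwards [h1, toComplexFun_section_integrable u] with x hx hux
    have h3 : hux.toLp = 0 := by
      apply (fourierBasis (T := 2 * Real.pi)).repr.injective
      ext n
      rw [fourierBasis_repr, map_zero]
      exact (congrFun (fourierCoeff_congr_ae hux.coeFn_toLp) n).trans (hx n)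
    have h4 := hux.coeFn_toLp
    rw [h3] at h4
    filter_upwards [h4, Lp.coeFn_zero ℂ 2 (AddCircle.haarAddCircle : Measure Torus)] with y hy hy0
    rw [hy0] at hy
    have : ‖RCLike.map 𝕜 ℂ (u (x, y))‖ = 0 := by
      rw [show RCLike.map 𝕜 ℂ (u (x, y)) = 0 from hy.symm, norm_zero]
    rwa [norm_map_complex, norm_eq_zero] at this
  refine (Lp.eq_zero_iff_ae_eq_zero).2 ?_
  have hm : MeasurableSet {p : ℝ × Torus | u p = 0} :=
    (Lp.stronglyMeasurable u).measurable (measurableSet_singleton 0)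
  have h5 : ∀ᵐ p ∂((volume : Measure ℝ).prod (AddCircle.haarAddCircle : Measure Torus)),
      u p = 0 := (Measure.ae_prod_iff_ae_ae hm).2 h2
  have hac : (volume : Measure (ℝ × Torus)) ≪
      (volume : Measure ℝ).prod (AddCircle.haarAddCircle : Measure Torus) := by
    rw [volume_eq_smul_prod]
    exact Measure.smul_absolutelyContinuous
  exact hac.ae_le h5

/-- The Fourier transform `û(·, n)` of `u`: Fourier series in `y`, then the `L²` (Plancherel)
Fourier transform in `x`. The variable `η` of the result is that of `e^{-2πixη}`, so that the
angular frequency is `ξ = 2πη`. -/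
def uhat (u : L2 𝕜) (n : ℤ) : Lp ℂ 2 (volume : Measure ℝ) := 𝓕 (mode u n)

theorem uhat_add (u v : L2 𝕜) (n : ℤ) : uhat (u + v) n = uhat u n + uhat v n := by
  rw [uhat, mode_add, FourierTransform.fourier_add]; rfl

theorem uhat_smul (a : 𝕜) (u : L2 𝕜) (n : ℤ) :
    uhat (a • u) n = RCLike.map 𝕜 ℂ a • uhat u n := by
  rw [uhat, mode_smul, FourierTransform.fourier_smul]; rfl

theorem ext_uhat {u v : L2 𝕜} (h : ∀ n, uhat u n = uhat v n) : u = v := by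
  rw [← sub_eq_zero]
  refine eq_zero_of_mode_eq_zero _ fun n => ?_
  have h1 : uhat (u - v) n = 0 := by
    have h2 := uhat_add (u - v) v n
    rw [sub_add_cancel, h n] at h2
    exact left_eq_add.mp (h2.trans (add_comm _ _)) 
  have h3 : ‖mode (u - v) n‖ = 0 := by
    rw [← Lp.norm_fourier_eq, show 𝓕 (mode (u - v) n) = 0 from h1, norm_zero]
  exact norm_eq_zero.1 h3

/-- `v` is the image of `u` under the Fourier multiplier with symbol `m`, the latter written in
terms of the angular frequency `ξ` and of `n`. -/
def IsMultiplierImage (m : ℝ → ℤ → ℂ) (u v : L2 𝕜) : Prop :=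
  ∀ n : ℤ, ∀ᵐ η : ℝ, uhat v n η = m (2 * Real.pi * η) n * uhat u n η

theorem IsMultiplierImage.add {m : ℝ → ℤ → ℂ} {u v u' v' : L2 𝕜} (h : IsMultiplierImage m u v)
    (h' : IsMultiplierImage m u' v') : IsMultiplierImage m (u + u') (v + v') := by
  intro n
  rw [uhat_add, uhat_add]
  filter_upwards [h n, h' n, Lp.coeFn_add (uhat u n) (uhat u' n),
    Lp.coeFn_add (uhat v n) (uhat v' n)] with η h1 h2 h3 h4
  rw [h3, h4, Pi.add_apply, Pi.add_apply, h1, h2, mul_add]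

theorem IsMultiplierImage.smul {m : ℝ → ℤ → ℂ} {u v : L2 𝕜} (a : 𝕜)
    (h : IsMultiplierImage m u v) : IsMultiplierImage m (a • u) (a • v) := by
  intro n
  rw [uhat_smul, uhat_smul]
  filter_upwards [h n, Lp.coeFn_smul (RCLike.map 𝕜 ℂ a) (uhat u n),
    Lp.coeFn_smul (RCLike.map 𝕜 ℂ a) (uhat v n)] with η h1 h3 h4
  rw [h3, h4, Pi.smul_apply, Pi.smul_apply, h1, smul_eq_mul, smul_eq_mul]
  ring

theorem IsMultiplierImage.unique {m : ℝ → ℤ → ℂ} {u v v' : L2 𝕜} (h : IsMultiplierImage m u v)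
    (h' : IsMultiplierImage m u v') : v = v' := by
  refine ext_uhat fun n => Lp.ext ?_
  filter_upwards [h n, h' n] with η h1 h2
  rw [h1, h2]

/-- The symbol `iξ` of `∂_x`. -/
def symbolDx (ξ : ℝ) (_n : ℤ) : ℂ := Complex.I * ξ

/-- The symbol `(iξ)⁻¹ (in)` of `∂_x⁻¹∂_y` (the point `ξ = 0` is a null set). -/
def symbolDxInvDy (ξ : ℝ) (n : ℤ) : ℂ := (Complex.I * ξ)⁻¹ * (Complex.I * n)

end Fourier

section EnergySpace

variable (𝕜 : Type*) [RCLike 𝕜]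

/-- The functions `u ∈ L²(ℝ × 𝕋)` such that `∂_x u ∈ L²` and `∂_x⁻¹∂_y u ∈ L²`. -/
def energySubmodule : Submodule 𝕜 (L2 𝕜) where
  carrier := {u | (∃ v, IsMultiplierImage symbolDx u v) ∧
    ∃ w, IsMultiplierImage symbolDxInvDy u w}
  add_mem' := by
    rintro u u' ⟨⟨v, hv⟩, w, hw⟩ ⟨⟨v', hv'⟩, w', hw'⟩
    exact ⟨⟨v + v', hv.add hv'⟩, w + w', hw.add hw'⟩
  smul_mem' := by
    rintro a u ⟨⟨v, hv⟩, w, hw⟩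
    exact ⟨⟨a • v, hv.smul a⟩, a • w, hw.smul a⟩
  zero_mem' := by
    have h : ∀ m, IsMultiplierImage m (0 : L2 𝕜) 0 := by
      intro m n
      have h0 : uhat (0 : L2 𝕜) n = 0 := by
        have := uhat_add (0 : L2 𝕜) 0 n
        rw [add_zero] at this
        exact left_eq_add.mp this
      rw [h0]
      filter_upwards [Lp.coeFn_zero ℂ 2 (volume : Measure ℝ)] with η h1
      rw [h1]; simp
    exact ⟨⟨0, h _⟩, 0, h _⟩

/-- The space `𝓔(ℝ × 𝕋)`. It is a type of its own, since it carries the norm of `𝓔` and not that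
of `L²`. -/
def EnergySpace : Type _ := ↥(energySubmodule 𝕜)

namespace EnergySpace

instance instAddCommGroup : AddCommGroup (EnergySpace 𝕜) :=
  inferInstanceAs (AddCommGroup ↥(energySubmodule 𝕜))

instance instModule : Module 𝕜 (EnergySpace 𝕜) :=
  inferInstanceAs (Module 𝕜 ↥(energySubmodule 𝕜))

/-- The inclusion of `𝓔` in `L²`. -/
def inclₗ : EnergySpace 𝕜 →ₗ[𝕜] L2 𝕜 := (energySubmodule 𝕜).subtype

theorem exists_dx (u : EnergySpace 𝕜) : ∃ v, IsMultiplierImage symbolDx (inclₗ 𝕜 u) v := u.2.1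

theorem exists_dxInvDy (u : EnergySpace 𝕜) :
    ∃ w, IsMultiplierImage symbolDxInvDy (inclₗ 𝕜 u) w := u.2.2

/-- `∂_x : 𝓔 → L²`. -/
def dxₗ : EnergySpace 𝕜 →ₗ[𝕜] L2 𝕜 where
  toFun u := (exists_dx 𝕜 u).choose
  map_add' u v := (exists_dx 𝕜 (u + v)).choose_spec.unique
    ((map_add (inclₗ 𝕜) u v).symm ▸ (exists_dx 𝕜 u).choose_spec.add (exists_dx 𝕜 v).choose_spec)
  map_smul' a u := (exists_dx 𝕜 (a • u)).choose_spec.unique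
    ((map_smul (inclₗ 𝕜) a u).symm ▸ (exists_dx 𝕜 u).choose_spec.smul a)

/-- `∂_x⁻¹∂_y : 𝓔 → L²`. -/
def dxInvDyₗ : EnergySpace 𝕜 →ₗ[𝕜] L2 𝕜 where
  toFun u := (exists_dxInvDy 𝕜 u).choose
  map_add' u v := (exists_dxInvDy 𝕜 (u + v)).choose_spec.unique
    ((map_add (inclₗ 𝕜) u v).symm ▸
      (exists_dxInvDy 𝕜 u).choose_spec.add (exists_dxInvDy 𝕜 v).choose_spec)
  map_smul' a u := (exists_dxInvDy 𝕜 (a • u)).choose_spec.unique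
    ((map_smul (inclₗ 𝕜) a u).symm ▸ (exists_dxInvDy 𝕜 u).choose_spec.smul a)

theorem dxₗ_spec (u : EnergySpace 𝕜) :
    IsMultiplierImage symbolDx (inclₗ 𝕜 u) (dxₗ 𝕜 u) := (exists_dx 𝕜 u).choose_spec

theorem dxInvDyₗ_spec (u : EnergySpace 𝕜) :
    IsMultiplierImage symbolDxInvDy (inclₗ 𝕜 u) (dxInvDyₗ 𝕜 u) :=
  (exists_dxInvDy 𝕜 u).choose_spec

/-- `u ↦ (u, ∂_x u, ∂_x⁻¹∂_y u)`, with values in the Hilbert sum of three copies of `L²`. -/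
def graphₗ : EnergySpace 𝕜 →ₗ[𝕜] PiLp 2 (fun _ : Fin 3 => L2 𝕜) where
  toFun u := WithLp.toLp 2 ![inclₗ 𝕜 u, dxₗ 𝕜 u, dxInvDyₗ 𝕜 u]
  map_add' u v := by
    ext i : 1
    fin_cases i <;> simp
  map_smul' a u := by
    ext i : 1
    fin_cases i <;> simp

theorem graphₗ_injective : Function.Injective (graphₗ 𝕜) := by
  intro u v h
  exact Subtype.ext (congrArg (fun z : PiLp 2 (fun _ : Fin 3 => L2 𝕜) => z 0) h)

instance instNormedAddCommGroup : NormedAddCommGroup (EnergySpace 𝕜) :=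
  NormedAddCommGroup.induced _ _ (graphₗ 𝕜) (graphₗ_injective 𝕜)

instance instNormedSpace : NormedSpace 𝕜 (EnergySpace 𝕜) where
  norm_smul_le a u := by
    change ‖graphₗ 𝕜 (a • u)‖ ≤ ‖a‖ * ‖graphₗ 𝕜 u‖
    rw [map_smul, norm_smul]

/-- The norm of `𝓔`: `‖u‖² = ‖u‖² + ‖∂_x u‖² + ‖∂_x⁻¹∂_y u‖²`, with `L²` norms on the right. -/
theorem norm_sq_eq (u : EnergySpace 𝕜) :
    ‖u‖ ^ 2 = ‖inclₗ 𝕜 u‖ ^ 2 + ‖dxₗ 𝕜 u‖ ^ 2 + ‖dxInvDyₗ 𝕜 u‖ ^ 2 := by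
  change ‖graphₗ 𝕜 u‖ ^ 2 = _
  rw [PiLp.norm_sq_eq_of_L2, Fin.sum_univ_three]
  rfl

theorem norm_coord_le (u : EnergySpace 𝕜) (i : Fin 3) : ‖graphₗ 𝕜 u i‖ ≤ 1 * ‖u‖ := by
  rw [one_mul]
  exact PiLp.norm_apply_le (graphₗ 𝕜 u) i

/-- The inclusion of `𝓔` in `L²`, as a bounded operator. -/
def incl : EnergySpace 𝕜 →L[𝕜] L2 𝕜 :=
  (inclₗ 𝕜).mkContinuous 1 fun u => norm_coord_le 𝕜 u 0

/-- `∂_x : 𝓔 → L²`, as a bounded operator. -/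
def dx : EnergySpace 𝕜 →L[𝕜] L2 𝕜 :=
  (dxₗ 𝕜).mkContinuous 1 fun u => norm_coord_le 𝕜 u 1

/-- `∂_x⁻¹∂_y : 𝓔 → L²`, as a bounded operator. -/
def dxInvDy : EnergySpace 𝕜 →L[𝕜] L2 𝕜 :=
  (dxInvDyₗ 𝕜).mkContinuous 1 fun u => norm_coord_le 𝕜 u 2

end EnergySpace

end EnergySpace

section Soliton

/-- The line soliton `φ_c(x) = c cosh⁻²(√(c/2) x)`. -/
def soliton (c x : ℝ) : ℝ := c * (Real.cosh (√(c / 2) * x))⁻¹ ^ 2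

/-- The kink `Q_c(x) = √(c/2) tanh(√(c/2) x)`. -/
def kink (c x : ℝ) : ℝ := √(c / 2) * Real.tanh (√(c / 2) * x)

theorem continuous_kink (c : ℝ) : Continuous (kink c) := by
  unfold kink
  simp only [Real.tanh_eq_sinh_div_cosh]
  exact continuous_const.mul ((Real.continuous_sinh.comp (by fun_prop)).div
    (Real.continuous_cosh.comp (by fun_prop)) fun x => (Real.cosh_pos _).ne')

theorem abs_kink_le (c x : ℝ) : |kink c x| ≤ √(c / 2) := by
  rw [kink, abs_mul, abs_of_nonneg (Real.sqrt_nonneg _)]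
  exact mul_le_of_le_one_right (Real.sqrt_nonneg _) (Real.abs_tanh_lt_one _).le

theorem deriv_kink {c : ℝ} (hc : 0 < c) (x : ℝ) : deriv (kink c) x = soliton c x / 2 := by
  have h : HasDerivAt (kink c) (√(c / 2) * ((Real.cosh (√(c / 2) * x) * √(c / 2) *
      Real.cosh (√(c / 2) * x) - Real.sinh (√(c / 2) * x) *
      (Real.sinh (√(c / 2) * x) * √(c / 2))) / Real.cosh (√(c / 2) * x) ^ 2)) x := by
    have hl : HasDerivAt (fun x : ℝ => √(c / 2) * x) √(c / 2) x := by
      simpa using (hasDerivAt_id x).const_mul √(c / 2)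
    have h1 := ((hl.sinh.div hl.cosh (Real.cosh_pos _).ne').const_mul √(c / 2))
    refine h1.congr_of_eventuallyEq (Filter.Eventually.of_forall fun t => ?_)
    simp [kink, Real.tanh_eq_sinh_div_cosh]
  rw [h.deriv, soliton]
  have hs : √(c / 2) * √(c / 2) = c / 2 := Real.mul_self_sqrt (by positivity)
  have hne := (Real.cosh_pos (√(c / 2) * x)).ne'
  have hcs := Real.cosh_sq (√(c / 2) * x)
  field_simp
  linear_combination (2 * √(c / 2) ^ 2) * hcs + 2 * hs

theorem continuous_soliton (c : ℝ) : Continuous (soliton c) := by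
  unfold soliton
  exact continuous_const.mul (((Real.continuous_cosh.comp (by fun_prop)).inv₀
    fun x => (Real.cosh_pos _).ne').pow 2)

theorem memLp_soliton {c : ℝ} (hc : 0 < c) : MemLp (soliton c) 2 volume := by
  have hk : 0 < √(c / 2) := Real.sqrt_pos.2 (by positivity)
  have hnn : ∀ x, 0 ≤ soliton c x := fun x => by unfold soliton; positivity
  have hle : ∀ x, soliton c x ≤ c := fun x => by
    unfold soliton
    refine mul_le_of_le_one_right hc.le (pow_le_one₀ (by positivity) ?_)
    exact inv_le_one_of_one_le₀ (Real.one_le_cosh _)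
  have hint : Integrable (soliton c) := by
    have hg := (integrable_inv_one_add_sq.comp_mul_left' hk.ne').const_mul c
    refine hg.mono' (continuous_soliton c).aestronglyMeasurable
      (Filter.Eventually.of_forall fun x => ?_)
    rw [Real.norm_of_nonneg (hnn x), soliton, inv_pow]
    refine mul_le_mul_of_nonneg_left (inv_anti₀ (by positivity) ?_) hc.le
    have h1 : |√(c / 2) * x| ≤ |Real.sinh (√(c / 2) * x)| := by
      rw [Real.abs_sinh]
      exact Real.self_le_sinh_iff.2 (abs_nonneg _)
    have h2 := sq_le_sq.2 h1
    rw [Real.cosh_sq]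
    linarith
  refine (memLp_two_iff_integrable_sq (continuous_soliton c).aestronglyMeasurable).2 ?_
  refine (hint.const_mul c).mono' ((continuous_soliton c).pow 2).aestronglyMeasurable
    (Filter.Eventually.of_forall fun x => ?_)
  rw [Real.norm_of_nonneg (by positivity), sq]
  exact mul_le_mul_of_nonneg_right (hle x) (hnn x)

variable (𝕜 : Type*) [RCLike 𝕜]

theorem memLp_lift {f : ℝ → ℝ} (hf : MemLp f 2 volume) :
    MemLp (fun p : ℝ × Torus => ((f p.1 : ℝ) : 𝕜)) 2 volume := by
  have h : MemLp (fun p : ℝ × Torus => f p.1) 2 volume := hf.comp_fst (volume : Measure Torus)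
  exact h.ofReal

theorem memLp_deriv_kink {c : ℝ} (hc : 0 < c) : MemLp (deriv (kink c)) 2 volume := by
  rw [show deriv (kink c) = fun x => (1 / 2) * soliton c x from
    funext fun x => by rw [deriv_kink hc]; ring]
  exact (memLp_soliton hc).const_mul _

/-- `φ_c`, as the element `(x, y) ↦ φ_c(x)` of `L²(ℝ × 𝕋)`. -/
def solitonL2 {c : ℝ} (hc : 0 < c) : L2 𝕜 := (memLp_lift 𝕜 (memLp_soliton hc)).toLp

/-- `Q_c'`, as the element `(x, y) ↦ Q_c'(x)` of `L²(ℝ × 𝕋)`. -/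
def kinkDerivL2 {c : ℝ} (hc : 0 < c) : L2 𝕜 := (memLp_lift 𝕜 (memLp_deriv_kink hc)).toLp

theorem memLp_kink_mul (c : ℝ) (u : L2 𝕜) :
    MemLp (fun p : ℝ × Torus => ((kink c p.1 : ℝ) : 𝕜) * u p) 2 volume := by
  refine (Lp.memLp u).of_le_mul (c := √(c / 2)) ?_ (Filter.Eventually.of_forall fun p => ?_)
  · exact ((RCLike.continuous_ofReal.comp
      ((continuous_kink c).comp continuous_fst)).aestronglyMeasurable).mul
      (Lp.aestronglyMeasurable u)
  · rw [norm_mul, RCLike.norm_ofReal]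
    exact mul_le_mul_of_nonneg_right (abs_kink_le c _) (norm_nonneg _)

/-- Multiplication by `Q_c(x)` on `L²(ℝ × 𝕋)`. -/
def mulKink (c : ℝ) : L2 𝕜 →L[𝕜] L2 𝕜 :=
  LinearMap.mkContinuous
    { toFun := fun u => (memLp_kink_mul 𝕜 c u).toLp
      map_add' := fun u v => by
        rw [← MemLp.toLp_add]
        refine MemLp.toLp_congr _ _ ?_
        filter_upwards [Lp.coeFn_add u v] with p hp
        rw [hp, Pi.add_apply, Pi.add_apply, mul_add]
      map_smul' := fun a u => by
        rw [RingHom.id_apply, ← MemLp.toLp_const_smul]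
        refine MemLp.toLp_congr _ _ ?_
        filter_upwards [Lp.coeFn_smul a u] with p hp
        rw [hp, Pi.smul_apply, Pi.smul_apply, smul_eq_mul, smul_eq_mul]
        ring }
    √(c / 2) fun u => by
      refine Lp.norm_le_mul_norm_of_ae_le_mul ?_
      filter_upwards [(memLp_kink_mul 𝕜 c u).coeFn_toLp] with p hp
      change ‖(memLp_kink_mul 𝕜 c u).toLp _ p‖ ≤ _
      rw [hp, norm_mul, RCLike.norm_ofReal]
      exact mul_le_mul_of_nonneg_right (abs_kink_le c _) (norm_nonneg _)

/-- `𝓛_c = -∂_x + ∂_x⁻¹∂_y - 2 Q_c`, as a bounded operator from `𝓔` to `L²`. -/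
def opL (c : ℝ) : EnergySpace 𝕜 →L[𝕜] L2 𝕜 :=
  -EnergySpace.dx 𝕜 + EnergySpace.dxInvDy 𝕜
    - (2 : 𝕜) • (mulKink 𝕜 c).comp (EnergySpace.incl 𝕜)

/-- `𝓔 ∩ (Q_c')^⊥`, with orthogonality in `L²(ℝ × 𝕋)`; it carries the norm of `𝓔`. -/
def energyPerp {c : ℝ} (hc : 0 < c) : Submodule 𝕜 (EnergySpace 𝕜) :=
  (Submodule.span 𝕜 {kinkDerivL2 𝕜 hc})ᗮ.comap (EnergySpace.incl 𝕜).toLinearMap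

end Soliton

end LineSoliton

end

open MeasureTheory FourierTransform
open scoped ENNReal

noncomputable section

namespace LineSoliton

/-! Everything is read off from the formal adjoint `opAdj`, that is `∂_x + ∂_x⁻¹∂_y - 2Q_c`,
decomposed into Fourier modes in `y`. Write `d = u'`, let `a` be the `n`-th mode of `∂_x⁻¹∂_y u`,
and let `Q = Q_c`.

Coercivity. The symbol `n/ξ` of `∂_x⁻¹∂_y` is real and that of `∂_x` is imaginary, so `⟪d, a⟫ =
-in‖u‖²` has real part zero. Integrating by parts, the other cross term becomes `2⟪Q'u, u⟫`. Hence
`‖d + a - 2Qu‖² = ‖d‖² + ‖a - 2Qu‖² + 2⟪Q'u, u⟫` with `Q' > 0` (`norm_sq_adjoint_mode`). For `n = 0`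
one has `a = 0`, and `Q² + Q' = c/2` controls `‖u‖`; for `n ≠ 0` the inequality `‖u‖² ≤ ‖d‖‖a‖`
does. The constant does not depend on `n` (`adjoint_mode_lower_bound`), and Parseval sums the
bounds.

Surjectivity. Since `opAdj` is bounded below on the complete space `𝓔`, its range is closed, and
Riesz representation on that range gives a weak solution in `L²` of `𝓛_c u = h`. A resolvent
argument on the Fourier side (`exists_energy_of_weak`) places it in `𝓔`.

Kernel. The zero mode solves `u' = -2Qu`, as `φ_c` does, so it is a multiple of `φ_c`. For `n ≠ 0`,
testing the equation against the antiderivative `v` of `u` yields `‖u‖² + ⟪Q'v, v⟫ = 0`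
(`mode_eq_zero_of_ne_zero`).

The Fredholm property follows from a one-dimensional kernel and full range. As `Q_c' = φ_c/2`, the
orthogonality condition selects a complement of the kernel, and the open mapping theorem bounds the
inverse there. -/

/-- `L²(ℝ; ℂ)`. -/
abbrev LineL2 : Type := Lp ℂ 2 (volume : Measure ℝ)

/-! ### Bounded multiplication operators on the line. -/

section Multiplication

variable {b : ℝ → ℂ} {C : ℝ}

theorem memLp_mul_of_bounded (hb : Measurable b) (hC : ∀ x, ‖b x‖ ≤ C) (f : LineL2) :
    MemLp (fun x => b x * f x) 2 volume :=
  (Lp.memLp f).of_le_mul (c := C) (hb.aestronglyMeasurable.mul (Lp.aestronglyMeasurable f))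
    (Filter.Eventually.of_forall fun x => by
      rw [norm_mul]; exact mul_le_mul_of_nonneg_right (hC x) (norm_nonneg _))

/-- Multiplication by a bounded measurable function on `L²(ℝ)`. -/
def mulBdd (hb : Measurable b) (hC : ∀ x, ‖b x‖ ≤ C) : LineL2 →L[ℂ] LineL2 :=
  LinearMap.mkContinuous
    { toFun := fun u => (memLp_mul_of_bounded hb hC u).toLp
      map_add' := fun u v => by
        rw [← MemLp.toLp_add]
        refine MemLp.toLp_congr _ _ ?_
        filter_upwards [Lp.coeFn_add u v] with p hp
        rw [hp, Pi.add_apply, Pi.add_apply, mul_add]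
      map_smul' := fun a u => by
        rw [RingHom.id_apply, ← MemLp.toLp_const_smul]
        refine MemLp.toLp_congr _ _ ?_
        filter_upwards [Lp.coeFn_smul a u] with p hp
        rw [hp, Pi.smul_apply, Pi.smul_apply, smul_eq_mul, smul_eq_mul]
        ring }
    C fun u => by
      refine Lp.norm_le_mul_norm_of_ae_le_mul ?_
      filter_upwards [(memLp_mul_of_bounded hb hC u).coeFn_toLp] with p hp
      change ‖(memLp_mul_of_bounded hb hC u).toLp _ p‖ ≤ _
      rw [hp, norm_mul]
      exact mul_le_mul_of_nonneg_right (hC p) (norm_nonneg _)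

theorem coeFn_mulBdd (hb : Measurable b) (hC : ∀ x, ‖b x‖ ≤ C) (f : LineL2) :
    mulBdd hb hC f =ᵐ[volume] fun x => b x * f x :=
  (memLp_mul_of_bounded hb hC f).coeFn_toLp

theorem norm_mulBdd_le (hb : Measurable b) (hC : ∀ x, ‖b x‖ ≤ C) (f : LineL2) :
    ‖mulBdd hb hC f‖ ≤ C * ‖f‖ := by
  refine Lp.norm_le_mul_norm_of_ae_le_mul ?_
  filter_upwards [coeFn_mulBdd hb hC f] with p hp
  rw [hp, norm_mul]
  exact mul_le_mul_of_nonneg_right (hC p) (norm_nonneg _)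

end Multiplication

/-- `d` is the derivative of `u` in `L²(ℝ)`, expressed on the Fourier side. -/
def IsDeriv (u d : LineL2) : Prop :=
  ∀ᵐ η : ℝ, (𝓕 d : LineL2) η = (Complex.I * ((2 * Real.pi * η : ℝ) : ℂ)) * (𝓕 u : LineL2) η

/-! ### Approximation in `H¹(ℝ)` by Schwartz functions. -/

section Density

open SchwartzMap

/-- The weight `(1 + η²)^{-1/2}`. -/
def weight (η : ℝ) : ℝ := (1 + ‖η‖ ^ 2) ^ (-(1 / 2) : ℝ)

theorem weight_pos (η : ℝ) : 0 < weight η := Real.rpow_pos_of_pos (by positivity) _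

theorem weight_sq (η : ℝ) : weight η ^ 2 * (1 + η ^ 2) = 1 := by
  have h : (0 : ℝ) < 1 + η ^ 2 := by positivity
  rw [weight, Real.norm_eq_abs, sq_abs, ← Real.rpow_natCast, ← Real.rpow_mul h.le]
  norm_num
  rw [Real.rpow_neg_one]
  field_simp

theorem hasTemperateGrowth_weight : weight.HasTemperateGrowth :=
  Function.hasTemperateGrowth_one_add_norm_sq_rpow ℝ (-(1 / 2))

theorem measurable_weight : Measurable fun η => (weight η : ℂ) := by
  unfold weight; fun_prop

theorem norm_weight_le (η : ℝ) : ‖(weight η : ℂ)‖ ≤ 1 := by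
  rw [Complex.norm_real, Real.norm_of_nonneg (weight_pos η).le]
  nlinarith [weight_sq η, weight_pos η, mul_nonneg (sq_nonneg (weight η)) (sq_nonneg η)]

theorem norm_mul_weight_le (η : ℝ) : ‖((η * weight η : ℝ) : ℂ)‖ ≤ 1 := by
  rw [Complex.norm_real, Real.norm_eq_abs, ← sq_le_one_iff_abs_le_one]
  nlinarith [weight_sq η, sq_nonneg (weight η)]

theorem norm_derivSymbol_mul_weight_le (η : ℝ) :
    ‖(Complex.I * ((2 * Real.pi * η : ℝ) : ℂ)) * (weight η : ℂ)‖ ≤ 2 * Real.pi := by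
  have h := norm_mul_weight_le η
  have h2 : (Complex.I * ((2 * Real.pi * η : ℝ) : ℂ)) * (weight η : ℂ)
      = (Complex.I * ((2 * Real.pi : ℝ) : ℂ)) * ((η * weight η : ℝ) : ℂ) := by push_cast; ring
  rw [h2, norm_mul, norm_mul, Complex.norm_I, one_mul, Complex.norm_real,
    Real.norm_of_nonneg Real.two_pi_pos.le]
  exact mul_le_of_le_one_right Real.two_pi_pos.le h

theorem isDeriv_schwartz (s : 𝓢(ℝ, ℂ)) : IsDeriv (s.toLp 2) ((derivCLM ℂ ℂ s).toLp 2) := by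
  unfold IsDeriv
  rw [SchwartzMap.toLp_fourier_eq, SchwartzMap.toLp_fourier_eq]
  filter_upwards [SchwartzMap.coeFn_toLp (𝓕 s) 2, SchwartzMap.coeFn_toLp (𝓕 (derivCLM ℂ ℂ s)) 2]
    with η h1 h2
  rw [h1, h2]
  have h := congrFun (Real.fourier_deriv (f := s) s.integrable s.differentiable
    (derivCLM ℂ ℂ s).integrable) η
  rw [SchwartzMap.fourier_coe, SchwartzMap.fourier_coe]
  refine Eq.trans ?_ (h.trans ?_)
  · rfl
  · rw [smul_eq_mul]; push_cast; ring

theorem measurable_derivSymbol_mul_weight :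
    Measurable fun η : ℝ => (Complex.I * ((2 * Real.pi * η : ℝ) : ℂ)) * (weight η : ℂ) :=
  (by fun_prop : Measurable fun η : ℝ => Complex.I * ((2 * Real.pi * η : ℝ) : ℂ)).mul
    measurable_weight

theorem measurable_mul_weight : Measurable fun η : ℝ => ((η * weight η : ℝ) : ℂ) := by
  have : (fun η : ℝ => ((η * weight η : ℝ) : ℂ)) = fun η : ℝ => (η : ℂ) * (weight η : ℂ) := by
    ext; push_cast; ring
  rw [this]
  exact (by fun_prop : Measurable fun η : ℝ => (η : ℂ)).mul measurable_weight

/-- Multiplication by `(1 + η²)^{-1/2}`. -/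
def weightMul : LineL2 →L[ℂ] LineL2 := mulBdd measurable_weight norm_weight_le

/-- Multiplication by `2πiη (1 + η²)^{-1/2}`. -/
def derivWeightMul : LineL2 →L[ℂ] LineL2 :=
  mulBdd measurable_derivSymbol_mul_weight norm_derivSymbol_mul_weight_le

theorem IsDeriv.derivWeightMul_eq {u d g : LineL2} (h : IsDeriv u d)
    (hg : weightMul g = 𝓕 u) : derivWeightMul g = 𝓕 d := by
  refine Lp.ext ?_
  have hW : weightMul g =ᵐ[volume] fun η => (weight η : ℂ) * g η := coeFn_mulBdd _ _ g
  have hD : derivWeightMul g =ᵐ[volume] fun η =>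
    (Complex.I * ((2 * Real.pi * η : ℝ) : ℂ)) * (weight η : ℂ) * g η := coeFn_mulBdd _ _ g
  rw [hg] at hW
  filter_upwards [h, hD, hW] with η h1 h2 h3
  rw [h2, h1, h3]; ring

/-- Parametrizes `H¹(ℝ)` by `L²(ℝ)`: dividing `𝓕 u` by the weight stays in `L²` exactly because `η 𝓕
u` is square integrable. -/
theorem IsDeriv.exists_weightMul_eq {u d : LineL2} (h : IsDeriv u d) :
    ∃ g, weightMul g = 𝓕 u := by
  let N := mulBdd measurable_mul_weight norm_mul_weight_le
  -- With `w` the weight, `1/w = w (1 + η²)`, so `𝓕 u / w = w 𝓕 u + η w (η 𝓕 u)`, where `η 𝓕 u =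
  -- (2πi)⁻¹ 𝓕 d`. Both summands are bounded multiples of `L²` functions.
  refine ⟨weightMul (𝓕 u) + (Complex.I * ((2 * Real.pi : ℝ) : ℂ))⁻¹ • N (𝓕 d), Lp.ext ?_⟩
  filter_upwards [h, coeFn_mulBdd measurable_weight norm_weight_le
      (weightMul (𝓕 u) + (Complex.I * ((2 * Real.pi : ℝ) : ℂ))⁻¹ • N (𝓕 d)),
    coeFn_mulBdd measurable_weight norm_weight_le (𝓕 u),
    coeFn_mulBdd measurable_mul_weight norm_mul_weight_le (𝓕 d),
    Lp.coeFn_add (weightMul (𝓕 u)) ((Complex.I * ((2 * Real.pi : ℝ) : ℂ))⁻¹ • N (𝓕 d)),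
    Lp.coeFn_smul (Complex.I * ((2 * Real.pi : ℝ) : ℂ))⁻¹ (N (𝓕 d))] with η h1 h2 h3 h4 h5 h6
  refine h2.trans ?_
  rw [h5, Pi.add_apply, h6, Pi.smul_apply, weightMul, h3, h4, h1, smul_eq_mul]
  have hw : (weight η : ℂ) ^ 2 * (1 + (η : ℂ) ^ 2) = 1 := by exact_mod_cast weight_sq η
  have hpi : ((Real.pi : ℝ) : ℂ) ≠ 0 := by exact_mod_cast Real.pi_ne_zero
  have hI := Complex.I_ne_zero
  push_cast
  field_simp
  linear_combination ((𝓕 u : LineL2) η) * hw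

/-- The weight is smooth of temperate growth, so the parametrization of `H¹` by `L²` sends Schwartz
functions to Schwartz functions. -/
theorem exists_fourier_eq_weightMul (s : 𝓢(ℝ, ℂ)) :
    ∃ r : 𝓢(ℝ, ℂ), weightMul (s.toLp 2) = 𝓕 (r.toLp 2 : LineL2) := by
  have hwt : (fun η => (weight η : ℂ)).HasTemperateGrowth :=
    Function.HasTemperateGrowth.comp Function.Complex.hasTemperateGrowth_ofReal
      hasTemperateGrowth_weight
  refine ⟨𝓕⁻ (smulLeftCLM ℂ (fun η => (weight η : ℂ)) s), ?_⟩
  rw [SchwartzMap.toLp_fourier_eq, FourierTransform.fourier_fourierInv_eq]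
  refine Lp.ext ?_
  filter_upwards [coeFn_mulBdd measurable_weight norm_weight_le (s.toLp 2),
    SchwartzMap.coeFn_toLp s 2,
    SchwartzMap.coeFn_toLp (smulLeftCLM ℂ (fun η => (weight η : ℂ)) s) 2] with η h1 h2 h3
  refine h1.trans ?_
  rw [h2, h3, SchwartzMap.smulLeftCLM_apply_apply hwt, smul_eq_mul]

/-- A closed property of pairs which holds for `(s, s')` with `s` a Schwartz function holds for
all `(u, u')` with `u` in `H¹(ℝ)`. -/
theorem IsDeriv.mem_closure {u d : LineL2} (h : IsDeriv u d) :
    (u, d) ∈ closure (Set.range fun s : 𝓢(ℝ, ℂ) =>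
      ((s.toLp 2 : LineL2), ((derivCLM ℂ ℂ s).toLp 2 : LineL2))) := by
  let Φ : LineL2 → LineL2 × LineL2 := fun g => (𝓕⁻ (weightMul g), 𝓕⁻ (derivWeightMul g))
  have hΦ : Continuous Φ := by
    have hc := (Lp.fourierTransformₗᵢ ℝ ℂ).symm.continuous
    exact (hc.comp weightMul.continuous).prodMk (hc.comp derivWeightMul.continuous)
  have hΦ2 : ∀ {u d g : LineL2}, IsDeriv u d → weightMul g = 𝓕 u → Φ g = (u, d) := by
    intro u d g h hg
    simp only [Φ, hg, h.derivWeightMul_eq hg]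
    exact Prod.ext (FourierTransform.fourierInv_fourier_eq u)
      (FourierTransform.fourierInv_fourier_eq d)
  obtain ⟨g, hg⟩ := h.exists_weightMul_eq
  rw [← hΦ2 h hg]
  have hdense : g ∈ closure (Set.range fun s : 𝓢(ℝ, ℂ) => (s.toLp 2 : LineL2)) :=
    (SchwartzMap.denseRange_toLpCLM (p := 2) ENNReal.ofNat_ne_top (F := ℂ) (E := ℝ)
      (μ := volume)) g
  -- `Φ` is continuous, so it carries the dense set of Schwartz functions to a set with `(u, d)` in
  -- its closure; the image consists of Schwartz pairs.
  refine closure_mono ?_ (image_closure_subset_closure_image hΦ (Set.mem_image_of_mem Φ hdense))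
  rintro _ ⟨_, ⟨s, rfl⟩, rfl⟩
  obtain ⟨r, hr⟩ := exists_fourier_eq_weightMul s
  exact ⟨r, (hΦ2 (isDeriv_schwartz r) hr).symm⟩

end Density

/-! ### Integration by parts and primitives in `H¹(ℝ)`. -/

section IntegrationByParts

open SchwartzMap ComplexConjugate

theorem IsDeriv.induction {P : LineL2 → LineL2 → Prop}
    (hP : IsClosed {p : LineL2 × LineL2 | P p.1 p.2})
    (hs : ∀ s : 𝓢(ℝ, ℂ), P (s.toLp 2) ((derivCLM ℂ ℂ s).toLp 2)) {u d : LineL2}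
    (h : IsDeriv u d) : P u d := by
  refine closure_minimal ?_ hP h.mem_closure
  rintro _ ⟨s, rfl⟩
  exact hs s

/-- Integration by parts against a real multiplier `b` with bounded derivative `b'`. -/
theorem IsDeriv.inner_mul_add {b b' : ℝ → ℝ} {C C' : ℝ} (hb : Measurable fun x => (b x : ℂ))
    (hC : ∀ x, ‖(b x : ℂ)‖ ≤ C) (hb' : Measurable fun x => (b' x : ℂ))
    (hC' : ∀ x, ‖(b' x : ℂ)‖ ≤ C') (hder : ∀ x, HasDerivAt b (b' x) x) {u d : LineL2}
    (h : IsDeriv u d) :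
    inner ℂ (mulBdd hb hC u) d + inner ℂ d (mulBdd hb hC u) + inner ℂ (mulBdd hb' hC' u) u = 0 := by
  refine h.induction (P := fun u d => inner ℂ (mulBdd hb hC u) d + inner ℂ d (mulBdd hb hC u)
    + inner ℂ (mulBdd hb' hC' u) u = 0) (isClosed_eq (by fun_prop) continuous_const) fun s => ?_
  have hS := SchwartzMap.coeFn_toLp s 2
  have hD := SchwartzMap.coeFn_toLp (derivCLM ℂ ℂ s) 2
  have hB := coeFn_mulBdd hb hC (s.toLp 2)
  have hB' := coeFn_mulBdd hb' hC' (s.toLp 2)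
  rw [L2.inner_def, L2.inner_def, L2.inner_def, ← integral_add (L2.integrable_inner _ _)
    (L2.integrable_inner _ _), ← integral_add ((L2.integrable_inner _ _).add
    (L2.integrable_inner _ _)) (L2.integrable_inner _ _)]
  have hae : (fun x => inner ℂ (mulBdd hb hC (s.toLp 2) x) ((derivCLM ℂ ℂ s).toLp 2 volume x) +
      inner ℂ ((derivCLM ℂ ℂ s).toLp 2 volume x) (mulBdd hb hC (s.toLp 2) x) +
      inner ℂ (mulBdd hb' hC' (s.toLp 2) x) (s.toLp 2 volume x)) =ᵐ[volume]
      fun x => (b' x : ℂ) * (conj (s x) * s x) +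
        b x * (conj (deriv s x) * s x + conj (s x) * deriv s x) := by
    filter_upwards [hS, hD, hB, hB'] with x h1 h2 h3 h4
    rw [h2, h3, h4, h1]
    simp only [RCLike.inner_apply, derivCLM_apply, map_mul, Complex.conj_ofReal]
    ring
  rw [integral_congr_ae hae]
  -- The integrand is the total derivative of `b |s|²`.
  refine integral_eq_zero_of_hasDerivAt_of_integrable
    (f := fun x => (b x : ℂ) * (conj (s x) * s x)) (fun x => ?_)
    ((((L2.integrable_inner (𝕜 := ℂ) _ _).add (L2.integrable_inner (𝕜 := ℂ) _ _)).add
      (L2.integrable_inner (𝕜 := ℂ) _ _)).congr hae) ?_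
  · have hs := s.hasDerivAt x
    have hs' : HasDerivAt (fun x => conj (s x)) (conj (deriv s x)) x := hs.star
    exact (hder x).ofReal_comp.mul (hs'.mul hs)
  · refine (L2.integrable_inner (𝕜 := ℂ) (mulBdd hb hC (s.toLp 2)) (s.toLp 2)).congr ?_
    filter_upwards [hS, hB] with x h1 h3
    rw [h3, h1]
    simp only [RCLike.inner_apply, map_mul, Complex.conj_ofReal]
    ring

/-- Integration by parts against `f` in `L²` whose derivative is `g f` with bounded real `g`. -/
theorem IsDeriv.inner_left_eq {f g : ℝ → ℝ} {C : ℝ} (hf : MemLp (fun x => (f x : ℂ)) 2 volume)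
    (hg : Measurable fun x => (g x : ℂ)) (hC : ∀ x, ‖(g x : ℂ)‖ ≤ C)
    (hder : ∀ x, HasDerivAt f (g x * f x) x) {u d : LineL2} (h : IsDeriv u d) :
    inner ℂ hf.toLp d + inner ℂ hf.toLp (mulBdd hg hC u) = 0 := by
  refine h.induction (P := fun u d => inner ℂ hf.toLp d + inner ℂ hf.toLp (mulBdd hg hC u) = 0)
    (isClosed_eq (by fun_prop) continuous_const) fun s => ?_
  have hS := SchwartzMap.coeFn_toLp s 2
  have hD := SchwartzMap.coeFn_toLp (derivCLM ℂ ℂ s) 2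
  have hB := coeFn_mulBdd hg hC (s.toLp 2)
  have hF := hf.coeFn_toLp
  rw [L2.inner_def, L2.inner_def, ← integral_add (L2.integrable_inner _ _)
    (L2.integrable_inner _ _)]
  have hae : (fun x => inner ℂ (hf.toLp _ x) ((derivCLM ℂ ℂ s).toLp 2 volume x) +
      inner ℂ (hf.toLp _ x) (mulBdd hg hC (s.toLp 2) x)) =ᵐ[volume]
      fun x => ((g x * f x : ℝ) : ℂ) * s x + f x * deriv s x := by
    filter_upwards [hS, hD, hB, hF] with x h1 h2 h3 h4
    rw [h2, h3, h4, h1]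
    simp only [RCLike.inner_apply, derivCLM_apply, Complex.conj_ofReal]
    push_cast
    ring
  rw [integral_congr_ae hae]
  refine integral_eq_zero_of_hasDerivAt_of_integrable
    (f := fun x => (f x : ℂ) * s x) (fun x => (hder x).ofReal_comp.mul (s.hasDerivAt x))
    (((L2.integrable_inner (𝕜 := ℂ) _ _).add (L2.integrable_inner (𝕜 := ℂ) _ _)).congr hae) ?_
  refine (L2.integrable_inner (𝕜 := ℂ) hf.toLp (s.toLp 2)).congr ?_
  filter_upwards [hS, hF] with x h1 h3
  rw [h3, h1]
  simp only [RCLike.inner_apply, Complex.conj_ofReal]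
  ring

/-- Shows that an oriented interval integral is continuous in `f` for the `L²` norm; one of the two
indicators is always zero. -/
theorem intervalIntegral_eq_inner (f : LineL2) (a b : ℝ) :
    ∫ t in a..b, f t =
      inner ℂ (indicatorConstLp 2 (measurableSet_Ioc (a := a) (b := b))
        (measure_Ioc_lt_top (μ := volume)).ne (1 : ℂ)) f -
      inner ℂ (indicatorConstLp 2 (measurableSet_Ioc (a := b) (b := a))
        (measure_Ioc_lt_top (μ := volume)).ne (1 : ℂ)) f := by
  rw [L2.inner_indicatorConstLp_one, L2.inner_indicatorConstLp_one]
  rfl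

/-- An element of `H¹(ℝ)` is a.e. equal to a primitive of its derivative. -/
theorem IsDeriv.ae_eq_primitive {u d : LineL2} (h : IsDeriv u d) :
    ∃ a : ℝ, ∃ z : ℂ, ∀ᵐ x : ℝ, u x = z + ∫ t in a..x, d t := by
  obtain ⟨p, hp, hlim⟩ := mem_closure_iff_seq_limit.1 h.mem_closure
  choose s hs using hp
  have h1 : Filter.Tendsto (fun n => ((s n).toLp 2 : LineL2)) Filter.atTop (nhds u) := by
    have := (continuous_fst.tendsto _).comp hlim
    refine this.congr fun n => ?_
    rw [Function.comp_apply, ← hs n]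
  have h2 : Filter.Tendsto (fun n => ((derivCLM ℂ ℂ (s n)).toLp 2 : LineL2)) Filter.atTop
      (nhds d) := by
    have := (continuous_snd.tendsto _).comp hlim
    refine this.congr fun n => ?_
    rw [Function.comp_apply, ← hs n]
  obtain ⟨ns, hns, hae⟩ := (tendstoInMeasure_of_tendsto_Lp h1).exists_seq_tendsto_ae
  have hS : ∀ᵐ x : ℝ, ∀ n, ((s n).toLp 2 : LineL2) x = s n x :=
    ae_all_iff.2 fun n => SchwartzMap.coeFn_toLp (s n) 2 volume
  have hgood : ∀ᵐ x : ℝ, Filter.Tendsto (fun i => s (ns i) x) Filter.atTop (nhds (u x)) := by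
    filter_upwards [hae, hS] with x hx hx2
    exact hx.congr fun i => hx2 _
  -- The base point must be one at which the approximating Schwartz functions converge.
  obtain ⟨a, ha⟩ := hgood.exists
  refine ⟨a, u a, ?_⟩
  filter_upwards [hgood] with x hx
  have h3 : Filter.Tendsto (fun i => ∫ t in a..x, ((derivCLM ℂ ℂ (s (ns i))).toLp 2 : LineL2) t)
      Filter.atTop (nhds (∫ t in a..x, d t)) := by
    simp only [intervalIntegral_eq_inner]
    have hc : Continuous fun f : LineL2 =>
        inner ℂ (indicatorConstLp 2 (measurableSet_Ioc (a := a) (b := x))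
          (measure_Ioc_lt_top (μ := volume)).ne (1 : ℂ)) f -
        inner ℂ (indicatorConstLp 2 (measurableSet_Ioc (a := x) (b := a))
          (measure_Ioc_lt_top (μ := volume)).ne (1 : ℂ)) f := by fun_prop
    exact (hc.tendsto d).comp (h2.comp hns.tendsto_atTop)
  refine tendsto_nhds_unique hx ((ha.add h3).congr fun i => ?_)
  have h4 : ∫ t in a..x, ((derivCLM ℂ ℂ (s (ns i))).toLp 2 : LineL2) t =
      ∫ t in a..x, deriv (s (ns i)) t := by
    refine intervalIntegral.integral_congr_ae ?_
    filter_upwards [SchwartzMap.coeFn_toLp (derivCLM ℂ ℂ (s (ns i))) 2] with t ht _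
    rw [ht, derivCLM_apply]
  rw [h4, intervalIntegral.integral_eq_sub_of_hasDerivAt (fun t _ => (s (ns i)).hasDerivAt t)
    ((derivCLM ℂ ℂ (s (ns i))).continuous.intervalIntegrable _ _)]
  ring

/-- If `v' = u` and `u' = d` then `⟪d, v⟫ = -‖u‖²`. -/
theorem IsDeriv.inner_deriv_eq {v u d : LineL2} (h : IsDeriv v u) (h' : IsDeriv u d) :
    inner ℂ d v = -inner ℂ u u := by
  rw [← Lp.inner_fourier_eq d v, ← Lp.inner_fourier_eq u u, L2.inner_def, L2.inner_def,
    ← integral_neg]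
  refine integral_congr_ae ?_
  filter_upwards [h, h'] with η h1 h2
  rw [h2, h1]
  simp only [RCLike.inner_apply, map_mul, Complex.conj_I, Complex.conj_ofReal]
  ring

end IntegrationByParts

/-! ### The kink, the soliton and the zero-mode equation. -/

section Kink

theorem hasDerivAt_kink {c : ℝ} (hc : 0 < c) (x : ℝ) :
    HasDerivAt (kink c) (soliton c x / 2) x := by
  have hd : DifferentiableAt ℝ (kink c) x := by
    have h : kink c = fun x => √(c / 2) * (Real.sinh (√(c / 2) * x) / Real.cosh (√(c / 2) * x)) := by
      funext x; rw [kink, Real.tanh_eq_sinh_div_cosh]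
    have h1 : DifferentiableAt ℝ (fun x => Real.sinh (√(c / 2) * x)) x := by fun_prop
    have h2 : DifferentiableAt ℝ (fun x => Real.cosh (√(c / 2) * x)) x := by fun_prop
    rw [h]
    exact (h1.div h2 (Real.cosh_pos _).ne').const_mul _
  rw [← deriv_kink hc]
  exact hd.hasDerivAt

theorem hasDerivAt_soliton (c x : ℝ) : HasDerivAt (soliton c) ((-2 * kink c x) * soliton c x) x := by
  have hl : HasDerivAt (fun x : ℝ => √(c / 2) * x) √(c / 2) x := by
    simpa using (hasDerivAt_id x).const_mul √(c / 2)
  have h := ((hl.cosh.inv (Real.cosh_pos _).ne').pow 2).const_mul c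
  refine h.congr_deriv ?_
  rw [kink, soliton, Real.tanh_eq_sinh_div_cosh]
  have hne := (Real.cosh_pos (√(c / 2) * x)).ne'
  simp only [Pi.inv_apply, Nat.cast_ofNat, Nat.add_one_sub_one, pow_one]
  generalize Real.sinh (√(c / 2) * x) = S
  generalize √(c / 2) = k at *
  field_simp

theorem soliton_pos {c : ℝ} (hc : 0 < c) (x : ℝ) : 0 < soliton c x := by
  unfold soliton
  have := Real.cosh_pos (√(c / 2) * x)
  positivity

theorem soliton_le {c : ℝ} (hc : 0 < c) (x : ℝ) : soliton c x ≤ c := by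
  unfold soliton
  refine mul_le_of_le_one_right hc.le (pow_le_one₀ (by positivity) ?_)
  exact inv_le_one_of_one_le₀ (Real.one_le_cosh _)

/-- The Riccati equation `Q² + Q' = c/2`; it recovers `‖u‖` from `Qu` and `⟪Q'u, u⟫` even though `Q`
vanishes at the origin. -/
theorem kink_sq_add {c : ℝ} (hc : 0 < c) (x : ℝ) : kink c x ^ 2 + soliton c x / 2 = c / 2 := by
  have hs : √(c / 2) ^ 2 = c / 2 := Real.sq_sqrt (by positivity)
  rw [kink, soliton, Real.tanh_eq_sinh_div_cosh, mul_pow, hs]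
  have hne := (Real.cosh_pos (√(c / 2) * x)).ne'
  have hcs := Real.cosh_sq (√(c / 2) * x)
  field_simp
  linear_combination -hcs

theorem measurable_kink (c : ℝ) : Measurable fun x => ((kink c x : ℝ) : ℂ) :=
  (Complex.continuous_ofReal.comp (continuous_kink c)).measurable

theorem measurable_soliton (c : ℝ) : Measurable fun x => ((soliton c x / 2 : ℝ) : ℂ) :=
  (Complex.continuous_ofReal.comp ((continuous_soliton c).div_const 2)).measurable

theorem norm_kink_le (c x : ℝ) : ‖((kink c x : ℝ) : ℂ)‖ ≤ √(c / 2) := by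
  rw [Complex.norm_real]; exact abs_kink_le c x

theorem norm_soliton_le {c : ℝ} (hc : 0 < c) (x : ℝ) : ‖((soliton c x / 2 : ℝ) : ℂ)‖ ≤ c := by
  rw [Complex.norm_real, Real.norm_of_nonneg (by linarith [soliton_pos hc x])]
  linarith [soliton_le hc x]

/-- Multiplication by `Q_c` on `L²(ℝ)`. -/
def lineKink (c : ℝ) : LineL2 →L[ℂ] LineL2 := mulBdd (measurable_kink c) (norm_kink_le c)

/-- Multiplication by `Q_c' = φ_c / 2` on `L²(ℝ)`. -/
def lineKinkDeriv {c : ℝ} (hc : 0 < c) : LineL2 →L[ℂ] LineL2 :=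
  mulBdd (measurable_soliton c) (norm_soliton_le hc)

theorem memLp_soliton_complex {c : ℝ} (hc : 0 < c) :
    MemLp (fun x => ((soliton c x : ℝ) : ℂ)) 2 volume := (memLp_soliton hc).ofReal

/-- `φ_c` as an element of `L²(ℝ)`. -/
def lineSoliton {c : ℝ} (hc : 0 < c) : LineL2 := (memLp_soliton_complex hc).toLp

theorem coeFn_lineKink (c : ℝ) (u : LineL2) :
    lineKink c u =ᵐ[volume] fun x => (kink c x : ℂ) * u x := coeFn_mulBdd _ _ u

theorem IsDeriv.inner_lineKink_add {c : ℝ} (hc : 0 < c) {u d : LineL2} (h : IsDeriv u d) :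
    inner ℂ (lineKink c u) d + inner ℂ d (lineKink c u) + inner ℂ (lineKinkDeriv hc u) u = 0 :=
  h.inner_mul_add _ _ _ _ (hasDerivAt_kink hc)

/-- `2 re ⟪Q u, u'⟫ = -⟪Q' u, u⟫`. -/
theorem IsDeriv.two_mul_re_inner_lineKink {c : ℝ} (hc : 0 < c) {u d : LineL2} (h : IsDeriv u d) :
    2 * (inner ℂ d (lineKink c u)).re = -(inner ℂ (lineKinkDeriv hc u) u).re := by
  have h1 := congrArg Complex.re (h.inner_lineKink_add hc)
  rw [← inner_conj_symm, Complex.add_re, Complex.add_re, Complex.conj_re, Complex.zero_re] at h1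
  linarith

/-- Since `φ_c' = -2Q_cφ_c`, integration by parts makes `φ_c` orthogonal to the range of the adjoint
on the zero mode. This puts `φ_c` weakly in the kernel of `𝓛_c`. -/
theorem IsDeriv.inner_lineSoliton {c : ℝ} (hc : 0 < c) {u d : LineL2} (h : IsDeriv u d) :
    inner ℂ (lineSoliton hc) (d - (2 : ℂ) • lineKink c u) = 0 := by
  have hm : Measurable fun x => ((-2 * kink c x : ℝ) : ℂ) :=
    (Complex.continuous_ofReal.comp ((continuous_kink c).const_mul (-2))).measurable
  have hb : ∀ x, ‖((-2 * kink c x : ℝ) : ℂ)‖ ≤ 2 * √(c / 2) := fun x => by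
    rw [Complex.norm_real, norm_mul, Real.norm_eq_abs (kink c x), norm_neg, Real.norm_two]
    exact mul_le_mul_of_nonneg_left (abs_kink_le c x) zero_le_two
  have h1 := h.inner_left_eq (memLp_soliton_complex hc) hm hb (hasDerivAt_soliton c)
  rw [← inner_add_right] at h1
  have h2 : mulBdd hm hb u = -((2 : ℂ) • lineKink c u) := by
    refine Lp.ext ?_
    filter_upwards [coeFn_mulBdd hm hb u, coeFn_lineKink c u, Lp.coeFn_neg ((2 : ℂ) • lineKink c u),
      Lp.coeFn_smul (2 : ℂ) (lineKink c u)] with x h1 h2 h3 h4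
    rw [h1, h3, Pi.neg_apply, h4, Pi.smul_apply, h2, smul_eq_mul]
    push_cast; ring
  rw [h2, ← sub_eq_add_neg] at h1
  exact h1

/-- The `L²` solutions of `u' = -2 Q_c u` are the multiples of `φ_c`. -/
theorem IsDeriv.eq_smul_lineSoliton {c : ℝ} (hc : 0 < c) {u d : LineL2} (h : IsDeriv u d)
    (hd : d = -((2 : ℂ) • lineKink c u)) : ∃ z : ℂ, u = z • lineSoliton hc := by
  obtain ⟨a, z, hF⟩ := h.ae_eq_primitive
  set F : ℝ → ℂ := fun x => z + ∫ t in a..x, d t with hFdef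
  have hFc : Continuous F := by
    refine continuous_const.add (intervalIntegral.continuous_primitive (fun p q => ?_) a)
    have hl : LocallyIntegrable d volume := (Lp.memLp d).locallyIntegrable (by norm_num)
    exact (hl.integrableOn_isCompact isCompact_uIcc).intervalIntegrable
  have hdF : ∀ᵐ x : ℝ, d x = -2 * kink c x * F x := by
    have h1 : d =ᵐ[volume] ⇑(-((2 : ℂ) • lineKink c u)) := by rw [← hd]
    filter_upwards [h1, hF, coeFn_lineKink c u, Lp.coeFn_neg ((2 : ℂ) • lineKink c u),
      Lp.coeFn_smul (2 : ℂ) (lineKink c u)] with x h1 h2 h3 h4 h5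
    rw [h1, h4, Pi.neg_apply, h5, Pi.smul_apply, h3, h2, smul_eq_mul]
    ring
  have hkc : Continuous fun x => -2 * (kink c x : ℂ) * F x :=
    (continuous_const.mul (Complex.continuous_ofReal.comp (continuous_kink c))).mul hFc
  -- Bootstrap: `d` is only an `L²` class, but it agrees a.e. with the continuous function `-2 Q F`,
  -- so the fundamental theorem of calculus applies at every point.
  have hFd : ∀ x, HasDerivAt F (-2 * kink c x * F x) x := fun x => by
    have h2 : F = fun x => z + ∫ t in a..x, -2 * (kink c t : ℂ) * F t := by
      funext y
      rw [hFdef]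
      refine congrArg (z + ·) (intervalIntegral.integral_congr_ae ?_)
      filter_upwards [hdF] with t ht _
      exact ht
    have h3 := (intervalIntegral.integral_hasDerivAt_right (hkc.intervalIntegrable a x)
      hkc.stronglyMeasurable.stronglyMeasurableAtFilter hkc.continuousAt).const_add z
    rw [← h2] at h3
    exact h3
  -- `F` and `φ_c` solve the same first-order linear equation and `φ_c` never vanishes, so the
  -- quotient is constant.
  have hG : ∀ x, HasDerivAt (fun x => F x / (soliton c x : ℂ)) 0 x := fun x => by
    have hne : (soliton c x : ℂ) ≠ 0 := by exact_mod_cast (soliton_pos hc x).ne'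
    refine ((hFd x).div (hasDerivAt_soliton c x).ofReal_comp hne).congr_deriv ?_
    push_cast
    field_simp
    ring
  have hconst := is_const_of_deriv_eq_zero (fun x => (hG x).differentiableAt)
    (fun x => (hG x).deriv)
  refine ⟨F 0 / (soliton c 0 : ℂ), Lp.ext ?_⟩
  filter_upwards [hF, Lp.coeFn_smul (F 0 / (soliton c 0 : ℂ)) (lineSoliton hc),
    (memLp_soliton_complex hc).coeFn_toLp] with x h1 h2 h3
  have hne : (soliton c x : ℂ) ≠ 0 := by exact_mod_cast (soliton_pos hc x).ne'
  rw [h1, h2, Pi.smul_apply, lineSoliton, h3, smul_eq_mul, hconst 0 x]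
  exact (div_mul_cancel₀ _ hne).symm

end Kink

/-! ### Mode-by-mode estimates for the adjoint and for the kernel. -/

section ModeEstimates

open ComplexConjugate

/-- `a` is the `n`-th mode of `∂_x⁻¹∂_y` applied to a function with `n`-th mode `u`. -/
def IsDerivInv (n : ℤ) (u a : LineL2) : Prop :=
  ∀ᵐ η : ℝ, (𝓕 a : LineL2) η = symbolDxInvDy (2 * Real.pi * η) n * (𝓕 u : LineL2) η

theorem ae_ne_zero : ∀ᵐ η : ℝ, η ≠ 0 := by
  simp [ae_iff]

/-- The factors `iξ` and `n/ξ` cancel in Plancherel's formula up to a constant. The result is purely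
imaginary, which removes a cross term, and for `n ≠ 0` it also bounds `‖u‖²`. -/
theorem inner_deriv_derivInv {n : ℤ} {u d a : LineL2} (hd : IsDeriv u d) (ha : IsDerivInv n u a) :
    inner ℂ d a = -(Complex.I * n) * inner ℂ u u := by
  rw [← Lp.inner_fourier_eq d a, ← Lp.inner_fourier_eq u u, L2.inner_def, L2.inner_def,
    ← integral_const_mul]
  refine integral_congr_ae ?_
  filter_upwards [hd, ha, ae_ne_zero] with η h1 h2 h3
  rw [h2, h1]
  have hne : ((2 * Real.pi * η : ℝ) : ℂ) ≠ 0 := by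
    exact_mod_cast mul_ne_zero Real.two_pi_pos.ne' h3
  have hI := Complex.I_ne_zero
  simp only [RCLike.inner_apply, map_mul, Complex.conj_I, Complex.conj_ofReal, symbolDxInvDy]
  field_simp

theorem inner_self_re_eq (u : LineL2) : (inner ℂ u u).re = ‖u‖ ^ 2 := by
  have := inner_self_eq_norm_sq (𝕜 := ℂ) u
  exact this

theorem inner_self_im_eq (u : LineL2) : (inner ℂ u u).im = 0 := inner_self_im (𝕜 := ℂ) u

theorem re_inner_deriv_derivInv {n : ℤ} {u d a : LineL2} (hd : IsDeriv u d)
    (ha : IsDerivInv n u a) : (inner ℂ d a).re = 0 := by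
  rw [inner_deriv_derivInv hd ha, Complex.mul_re, inner_self_im_eq]
  simp

theorem norm_sq_le_mul_of_ne_zero {n : ℤ} (hn : n ≠ 0) {u d a : LineL2} (hd : IsDeriv u d)
    (ha : IsDerivInv n u a) : ‖u‖ ^ 2 ≤ ‖d‖ * ‖a‖ := by
  refine le_trans ?_ (norm_inner_le_norm (𝕜 := ℂ) d a)
  rw [inner_deriv_derivInv hd ha, norm_mul, norm_neg, norm_mul, Complex.norm_I, one_mul,
    Complex.norm_intCast, ← inner_self_re_eq u]
  have h1 : (1 : ℝ) ≤ |(n : ℝ)| := by exact_mod_cast Int.one_le_abs hn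
  have h2 : (inner ℂ u u).re ≤ ‖inner ℂ u u‖ := Complex.re_le_norm _
  nlinarith [norm_nonneg (inner ℂ u u)]

theorem IsDerivInv.eq_zero {u a : LineL2} (ha : IsDerivInv 0 u a) : a = 0 := by
  have h : (𝓕 a : LineL2) = 0 := by
    refine Lp.ext ?_
    filter_upwards [ha, Lp.coeFn_zero ℂ 2 (volume : Measure ℝ)] with η h1 h2
    rw [h1, h2]
    simp [symbolDxInvDy]
  rw [← norm_eq_zero, ← Lp.norm_fourier_eq, h, norm_zero]

theorem lineKinkDeriv_re_inner_nonneg {c : ℝ} (hc : 0 < c) (u : LineL2) :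
    0 ≤ (inner ℂ (lineKinkDeriv hc u) u).re := by
  have h : inner ℂ (lineKinkDeriv hc u) u =
      ((∫ x, soliton c x / 2 * ‖u x‖ ^ 2 : ℝ) : ℂ) := by
    rw [L2.inner_def, ← integral_complex_ofReal]
    refine integral_congr_ae ?_
    filter_upwards [coeFn_mulBdd (measurable_soliton c) (norm_soliton_le hc) u] with x hx
    rw [lineKinkDeriv, hx]
    simp only [RCLike.inner_apply, map_mul, Complex.conj_ofReal]
    push_cast
    rw [← Complex.mul_conj']
    ring
  rw [h, Complex.ofReal_re]
  exact integral_nonneg fun x => mul_nonneg (by linarith [soliton_pos hc x]) (sq_nonneg _)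

theorem norm_lineKink_sq_add {c : ℝ} (hc : 0 < c) (u : LineL2) :
    ‖lineKink c u‖ ^ 2 + (inner ℂ (lineKinkDeriv hc u) u).re = c / 2 * ‖u‖ ^ 2 := by
  have h : inner ℂ (lineKink c u) (lineKink c u) + inner ℂ (lineKinkDeriv hc u) u =
      ((c / 2 : ℝ) : ℂ) * inner ℂ u u := by
    rw [L2.inner_def, L2.inner_def, L2.inner_def, ← integral_add (L2.integrable_inner _ _)
      (L2.integrable_inner _ _), ← integral_const_mul]
    refine integral_congr_ae ?_
    filter_upwards [coeFn_mulBdd (measurable_soliton c) (norm_soliton_le hc) u,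
      coeFn_lineKink c u] with x h1 h2
    rw [lineKinkDeriv, h1, h2, ← kink_sq_add hc x]
    simp only [RCLike.inner_apply, map_mul, Complex.conj_ofReal]
    push_cast
    ring
  have h' := congrArg Complex.re h
  rw [Complex.add_re, inner_self_re_eq, Complex.re_ofReal_mul, inner_self_re_eq] at h'
  exact h'

theorem norm_lineKink_le (c : ℝ) (u : LineL2) : ‖lineKink c u‖ ≤ √(c / 2) * ‖u‖ :=
  norm_mulBdd_le _ _ u

/-- The factorization of `𝓛_c 𝓛_c^*`, mode by mode. -/
theorem norm_sq_adjoint_mode {c : ℝ} (hc : 0 < c) {n : ℤ} {u d a : LineL2} (hd : IsDeriv u d)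
    (ha : IsDerivInv n u a) :
    ‖d + a - (2 : ℂ) • lineKink c u‖ ^ 2 = ‖d‖ ^ 2 + ‖a - (2 : ℂ) • lineKink c u‖ ^ 2 +
      2 * (inner ℂ (lineKinkDeriv hc u) u).re := by
  have h1 := norm_add_sq (𝕜 := ℂ) d (a - (2 : ℂ) • lineKink c u)
  rw [add_sub_assoc, h1, inner_sub_right, inner_smul_right]
  -- The sign of `∂_x` in the adjoint is what makes this cross term contribute `+2⟪Q'u, u⟫`.
  have h2 := hd.two_mul_re_inner_lineKink hc
  have h3 := re_inner_deriv_derivInv hd ha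
  have h4 : RCLike.re (inner ℂ d a - 2 * inner ℂ d (lineKink c u)) =
      (inner ℂ d a).re - 2 * (inner ℂ d (lineKink c u)).re := by
    change (_ - _ : ℂ).re = _
    simp
  rw [h4, h3]
  linarith

/-- The constant in the lower bound for `𝓛_c^*`. -/
def coercConst (c : ℝ) : ℝ := 1 / c + 3 + (1 + 2 * c) * (1 + 4 * c)

theorem coercConst_pos {c : ℝ} (hc : 0 < c) : 0 < coercConst c := by
  unfold coercConst; positivity

/-- The term `1/c` of `coercConst` serves the zero mode and the product `(1 + 2c)(1 + 4c)` the
others. Independence of `n` is what allows summation over the modes. -/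
theorem adjoint_mode_lower_bound {c : ℝ} (hc : 0 < c) {n : ℤ} {u d a : LineL2}
    (hd : IsDeriv u d) (ha : IsDerivInv n u a) :
    ‖u‖ ^ 2 + ‖d‖ ^ 2 + ‖a‖ ^ 2 ≤ coercConst c * ‖d + a - (2 : ℂ) • lineKink c u‖ ^ 2 := by
  rw [norm_sq_adjoint_mode hc hd ha]
  have hP := lineKinkDeriv_re_inner_nonneg hc u
  have hQ := norm_lineKink_sq_add hc u
  have hk := norm_lineKink_le c u
  have hs : √(c / 2) ^ 2 = c / 2 := Real.sq_sqrt (by positivity)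
  have hk0 := Real.sqrt_nonneg (c / 2)
  set P := (inner ℂ (lineKinkDeriv hc u) u).re
  set k := √(c / 2)
  by_cases hn : n = 0
  · subst hn
    rw [ha.eq_zero, zero_sub, norm_neg, norm_smul, norm_zero, coercConst]
    norm_num
    -- `4‖Qu‖² + 2P ≥ 2(‖Qu‖² + P) = c‖u‖²`.
    have h1 : c * ‖u‖ ^ 2 ≤ ‖d‖ ^ 2 + (2 * ‖lineKink c u‖) ^ 2 + 2 * P := by
      nlinarith [sq_nonneg ‖d‖, sq_nonneg ‖lineKink c u‖]
    set T := ‖d‖ ^ 2 + (2 * ‖lineKink c u‖) ^ 2 + 2 * P with hT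
    have hdT : ‖d‖ ^ 2 ≤ T := by nlinarith [sq_nonneg ‖lineKink c u‖]
    have huT : ‖u‖ ^ 2 ≤ c⁻¹ * T := by
      rw [inv_mul_eq_div, le_div_iff₀ hc]; linarith
    have hT0 : 0 ≤ T := le_trans (sq_nonneg _) hdT
    have : 0 ≤ (2 + (1 + 2 * c) * (1 + 4 * c)) * T := by positivity
    nlinarith
  · have h1 := norm_sq_le_mul_of_ne_zero hn hd ha
    set t := ‖a - (2 : ℂ) • lineKink c u‖ with ht
    have h2 : ‖a‖ ≤ t + 2 * k * ‖u‖ := by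
      calc ‖a‖ = ‖(a - (2 : ℂ) • lineKink c u) + (2 : ℂ) • lineKink c u‖ := by
            rw [sub_add_cancel]
        _ ≤ t + ‖(2 : ℂ) • lineKink c u‖ := norm_add_le _ _
        _ ≤ t + 2 * k * ‖u‖ := by
            rw [norm_smul, Complex.norm_ofNat]; nlinarith
    have ht0 : 0 ≤ t := norm_nonneg _
    have hd0 := norm_nonneg d
    have hu0 := norm_nonneg u
    have ha0 := norm_nonneg a
    -- Insert the bound for `‖a‖` into `‖u‖² ≤ ‖d‖‖a‖` and absorb: `2k‖d‖‖u‖` is at most half of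
    -- `‖u‖² + 4k²‖d‖²`, with `4k² = 2c`.
    have h3 : ‖u‖ ^ 2 ≤ (1 + 2 * c) * (‖d‖ ^ 2 + t ^ 2) := by
      have e1 : ‖u‖ ^ 2 ≤ ‖d‖ * (t + 2 * k * ‖u‖) := h1.trans (mul_le_mul_of_nonneg_left h2 hd0)
      have e2 : 0 ≤ c * t ^ 2 := by positivity
      have e3 : (2 * k * ‖d‖) ^ 2 = 2 * c * ‖d‖ ^ 2 := by
        rw [mul_pow, mul_pow, hs]; ring
      nlinarith [sq_nonneg (‖u‖ - 2 * k * ‖d‖), sq_nonneg (‖d‖ - t)]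
    have h4 : ‖a‖ ^ 2 ≤ 2 * t ^ 2 + 4 * c * ‖u‖ ^ 2 := by
      have e1 : ‖a‖ ^ 2 ≤ (t + 2 * k * ‖u‖) ^ 2 := pow_le_pow_left₀ ha0 h2 2
      have e3 : (2 * k * ‖u‖) ^ 2 = 2 * c * ‖u‖ ^ 2 := by
        rw [mul_pow, mul_pow, hs]; ring
      nlinarith [sq_nonneg (t - 2 * k * ‖u‖)]
    have hS : ‖d‖ ^ 2 + t ^ 2 ≤ ‖d‖ ^ 2 + t ^ 2 + 2 * P := by linarith
    have h5 : ‖u‖ ^ 2 + ‖d‖ ^ 2 + ‖a‖ ^ 2 ≤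
        (3 + (1 + 2 * c) * (1 + 4 * c)) * (‖d‖ ^ 2 + t ^ 2) := by
      have : 4 * c * ‖u‖ ^ 2 ≤ 4 * c * ((1 + 2 * c) * (‖d‖ ^ 2 + t ^ 2)) :=
        mul_le_mul_of_nonneg_left h3 (by positivity)
      nlinarith [sq_nonneg ‖d‖, sq_nonneg t]
    refine h5.trans (mul_le_mul ?_ hS (by positivity) (coercConst_pos hc).le)
    have : 0 ≤ 1 / c := by positivity
    unfold coercConst
    linarith

/-- The nonzero modes of an element of the kernel of `𝓛_c` vanish. -/
theorem mode_eq_zero_of_ne_zero {c : ℝ} (hc : 0 < c) {n : ℤ} (hn : n ≠ 0) {u d a : LineL2}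
    (hd : IsDeriv u d) (ha : IsDerivInv n u a) (h : -d + a - (2 : ℂ) • lineKink c u = 0) :
    u = 0 := by
  set z : ℂ := (Complex.I * n)⁻¹ with hz
  have hn' : (Complex.I * n : ℂ) ≠ 0 :=
    mul_ne_zero Complex.I_ne_zero (by exact_mod_cast hn)
  -- As `a` has symbol `n/ξ` relative to `u`, dividing it by `in` gives the symbol `1/(iξ)`: `v` is
  -- an antiderivative of `u` in `L²`.
  set v : LineL2 := z • a with hv
  have hav : a = (Complex.I * n : ℂ) • v := by rw [hv, smul_smul, hz, mul_inv_cancel₀ hn', one_smul]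
  have hvu : IsDeriv v u := by
    unfold IsDeriv
    have hFv : (𝓕 v : LineL2) = z • (𝓕 a : LineL2) := FourierTransform.fourier_smul z a
    rw [hFv]
    filter_upwards [ha, Lp.coeFn_smul z (𝓕 a : LineL2), ae_ne_zero] with η h1 h2 h3
    rw [h2, Pi.smul_apply, h1, hz, smul_eq_mul, symbolDxInvDy]
    have hne : ((2 * Real.pi * η : ℝ) : ℂ) ≠ 0 := by
      exact_mod_cast mul_ne_zero Real.two_pi_pos.ne' h3
    have hI := Complex.I_ne_zero
    field_simp
  clear_value v
  have h1 := hvu.inner_deriv_eq hd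
  have h2 := hvu.two_mul_re_inner_lineKink hc
  have h3 := lineKinkDeriv_re_inner_nonneg hc v
  have h4 : inner ℂ (-d + a - (2 : ℂ) • lineKink c u) v = 0 := by rw [h, inner_zero_left]
  have h5 : inner ℂ (lineKink c u) v = inner ℂ u (lineKink c v) := by
    rw [L2.inner_def, L2.inner_def]
    refine integral_congr_ae ?_
    filter_upwards [coeFn_lineKink c u, coeFn_lineKink c v] with x e1 e2
    rw [e1, e2]
    simp only [RCLike.inner_apply, map_mul, Complex.conj_ofReal]
    ring
  rw [inner_sub_left, inner_add_left, inner_neg_left, h1, hav, inner_smul_left, inner_smul_left,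
    h5] at h4
  -- In the real part the term with `in‖v‖²` drops out, leaving `‖u‖² + ⟪Q'v, v⟫ = 0`.
  have h6 := congrArg Complex.re h4
  simp only [Complex.add_re, Complex.sub_re, Complex.neg_re, Complex.mul_re, map_mul,
    Complex.conj_I, Complex.zero_re, inner_self_im_eq, inner_self_re_eq] at h6
  simp at h6
  have : ‖u‖ ^ 2 = 0 := le_antisymm (by nlinarith) (sq_nonneg _)
  exact norm_eq_zero.1 (pow_eq_zero_iff two_ne_zero |>.1 this)

end ModeEstimates

/-! ### Parseval's identity for the modes in `y`. -/

section Parseval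

variable {𝕜 : Type*} [RCLike 𝕜]

theorem enorm_sq_eq_lintegral {α E : Type*} [MeasurableSpace α] {μ : Measure α}
    [NormedAddCommGroup E] (f : Lp E 2 μ) : ‖f‖ₑ ^ 2 = ∫⁻ x, ‖f x‖ₑ ^ 2 ∂μ := by
  have h := eLpNorm_nnreal_pow_eq_lintegral (f := f) (μ := μ) (p := 2) two_ne_zero
  rw [Lp.enorm_def]
  simpa using h

theorem lintegral_enorm_sq_eq_tsum_fourierCoeff {f : Torus → ℂ}
    (hf : MemLp f 2 AddCircle.haarAddCircle) :
    ∫⁻ y, ‖f y‖ₑ ^ 2 ∂AddCircle.haarAddCircle = ∑' n, ‖fourierCoeff f n‖ₑ ^ 2 := by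
  have hsq : ∀ z : ℂ, ENNReal.ofReal (‖z‖ ^ 2) = ‖z‖ₑ ^ 2 := fun z => by
    rw [ENNReal.ofReal_pow (norm_nonneg _), ofReal_norm]
  have h := hasSum_sq_fourierCoeff hf.toLp
  rw [fourierCoeff_congr_ae hf.coeFn_toLp] at h
  have hint : Integrable (fun y => ‖f y‖ ^ 2) AddCircle.haarAddCircle :=
    (memLp_two_iff_integrable_sq_norm hf.aestronglyMeasurable).1 hf
  have h2 : ∫ y, ‖hf.toLp f y‖ ^ 2 ∂AddCircle.haarAddCircle =
      ∫ y, ‖f y‖ ^ 2 ∂AddCircle.haarAddCircle := by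
    refine integral_congr_ae ?_
    filter_upwards [hf.coeFn_toLp] with y hy
    rw [hy]
  rw [h2] at h
  have h3 := ofReal_integral_eq_lintegral_ofReal hint
    (Filter.Eventually.of_forall fun y => sq_nonneg _)
  rw [← h.tsum_eq, ENNReal.ofReal_tsum_of_nonneg (fun n => sq_nonneg _) h.summable] at h3
  simp only [hsq] at h3
  exact h3.symm

theorem enorm_sq_eq_tsum_mode (u : L2 𝕜) :
    ‖u‖ₑ ^ 2 = ENNReal.ofReal (2 * Real.pi) * ∑' n, ‖mode u n‖ₑ ^ 2 := by
  have hmem := memLp_prod_haar (memLp_toComplexFun u)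
  have h1 : ∀ p, ‖u p‖ₑ = ‖toComplexFun u p‖ₑ := fun p => by
    rw [← ofReal_norm, ← ofReal_norm, toComplexFun, norm_map_complex]
  rw [enorm_sq_eq_lintegral]
  simp only [h1]
  rw [volume_eq_smul_prod, lintegral_smul_measure, smul_eq_mul,
    lintegral_prod _ (hmem.aestronglyMeasurable.enorm.pow_const _)]
  congr 1
  calc _ = ∫⁻ x, ∑' n, ‖modeFun u n x‖ₑ ^ 2 := by
        refine lintegral_congr_ae ?_
        filter_upwards [toComplexFun_section_integrable u] with x hx
        exact lintegral_enorm_sq_eq_tsum_fourierCoeff hx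
    _ = ∑' n, ∫⁻ x, ‖modeFun u n x‖ₑ ^ 2 :=
        lintegral_tsum fun n => (memLp_modeFun u n).aestronglyMeasurable.enorm.pow_const _
    _ = _ := by
        refine tsum_congr fun n => ?_
        rw [enorm_sq_eq_lintegral]
        refine lintegral_congr_ae ?_
        filter_upwards [(memLp_modeFun u n).coeFn_toLp] with x hx
        rw [mode, hx]

/-- Parseval's identity in `y`. -/
theorem hasSum_norm_mode_sq (u : L2 𝕜) :
    HasSum (fun n => 2 * Real.pi * ‖mode u n‖ ^ 2) (‖u‖ ^ 2) := by
  have h := enorm_sq_eq_tsum_mode u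
  rw [← ENNReal.tsum_mul_left] at h
  have hne : ∑' n, ENNReal.ofReal (2 * Real.pi) * ‖mode u n‖ₑ ^ 2 ≠ ∞ := by
    rw [← h]; finiteness
  have h2 := ENNReal.hasSum_toReal hne
  rw [← ENNReal.tsum_toReal_eq (fun n => by finiteness), ← h] at h2
  have h3 : (‖u‖ₑ ^ 2).toReal = ‖u‖ ^ 2 := by simp
  rw [h3] at h2
  convert h2 using 2 with n
  rw [ENNReal.toReal_mul, ENNReal.toReal_ofReal Real.two_pi_pos.le]
  simp

theorem norm_mode_le (u : L2 𝕜) (n : ℤ) : ‖mode u n‖ ≤ ‖u‖ := by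
  have h := le_hasSum (hasSum_norm_mode_sq u) n fun m _ => by positivity
  have h1 : (1 : ℝ) ≤ 2 * Real.pi := by linarith [Real.pi_gt_three]
  refine le_of_sq_le_sq ?_ (norm_nonneg _)
  nlinarith [sq_nonneg ‖mode u n‖]

/-- The coefficient map `u ↦ u_n` as an additive homomorphism. -/
def modeHom (n : ℤ) : L2 𝕜 →+ LineL2 :=
  AddMonoidHom.mk' (fun u => mode u n) fun u v => mode_add u v n

theorem modeHom_apply (n : ℤ) (u : L2 𝕜) : modeHom n u = mode u n := rfl

theorem continuous_mode (n : ℤ) : Continuous fun u : L2 𝕜 => mode u n :=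
  AddMonoidHomClass.continuous_of_bound (modeHom n) 1 fun u => by
    rw [one_mul]; exact norm_mode_le u n

theorem mode_sub (u v : L2 𝕜) (n : ℤ) : mode (u - v) n = mode u n - mode v n :=
  map_sub (modeHom n) u v

theorem mode_neg (u : L2 𝕜) (n : ℤ) : mode (-u) n = -mode u n := map_neg (modeHom n) u

theorem mode_two_smul (u : L2 𝕜) (n : ℤ) : mode ((2 : 𝕜) • u) n = (2 : ℂ) • mode u n := by
  rw [two_smul, mode_add, two_smul]

theorem ext_mode {u v : L2 𝕜} (h : ∀ n, mode u n = mode v n) : u = v :=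
  sub_eq_zero.1 (eq_zero_of_mode_eq_zero _ fun n => by rw [mode_sub, h, sub_self])

/-- Polarization of Parseval's identity. Real parts are kept because the modes are complex even when
`𝕜` is real; they suffice for the weak formulation below. -/
theorem hasSum_re_inner_mode (u v : L2 𝕜) :
    HasSum (fun n => 2 * Real.pi * (inner ℂ (mode u n) (mode v n)).re)
      (RCLike.re (inner 𝕜 u v)) := by
  have h := (((hasSum_norm_mode_sq (u + v)).sub (hasSum_norm_mode_sq u)).sub
    (hasSum_norm_mode_sq v)).div_const 2
  rw [re_inner_eq_norm_add_mul_self_sub_norm_mul_self_sub_norm_mul_self_div_two]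
  simp only [← sq]
  have he : (fun n => 2 * Real.pi * (inner ℂ (mode u n) (mode v n)).re) = fun n =>
      (2 * Real.pi * ‖mode (u + v) n‖ ^ 2 - 2 * Real.pi * ‖mode u n‖ ^ 2
        - 2 * Real.pi * ‖mode v n‖ ^ 2) / 2 := by
    funext n
    have h1 := re_inner_eq_norm_add_mul_self_sub_norm_mul_self_sub_norm_mul_self_div_two (𝕜 := ℂ)
      (mode u n) (mode v n)
    rw [RCLike.re_eq_complex_re] at h1
    rw [h1, mode_add]
    ring
  rw [he]
  exact h

theorem mode_mulKink (c : ℝ) (u : L2 𝕜) (n : ℤ) :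
    mode (mulKink 𝕜 c u) n = lineKink c (mode u n) := by
  refine Lp.ext ?_
  filter_upwards [(memLp_modeFun (mulKink 𝕜 c u) n).coeFn_toLp, (memLp_modeFun u n).coeFn_toLp,
    coeFn_lineKink c (mode u n), ae_section_of_ae (memLp_kink_mul 𝕜 c u).coeFn_toLp]
    with x h1 h2 h3 h4
  rw [h3, mode, h1, mode, h2, modeFun, modeFun, ← fourierCoeff.const_mul]
  refine congrFun (fourierCoeff_congr_ae ?_) n
  filter_upwards [h4] with y hy
  change RCLike.map 𝕜 ℂ ((memLp_kink_mul 𝕜 c u).toLp _ (x, y)) = _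
  rw [hy, map_complex_mul, toComplexFun]
  congr 1
  simp

end Parseval

/-! ### Building a function from its modes. -/

section Synthesis

theorem memLp_mul_fourier (n : ℤ) (h : LineL2) :
    MemLp (fun p : ℝ × Torus => h p.1 * fourier n p.2) 2 volume := by
  have h1 : MemLp (fun p : ℝ × Torus => h p.1) 2 volume :=
    (Lp.memLp h).comp_fst (volume : Measure Torus)
  refine h1.of_le (h1.aestronglyMeasurable.mul
    (((map_continuous (fourier n)).comp continuous_snd).aestronglyMeasurable)) ?_
  refine Filter.Eventually.of_forall fun p => ?_
  rw [norm_mul, fourier_apply, Circle.norm_coe, mul_one]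

/-- The function `(x, y) ↦ h(x) e^{iny}` as an element of `L²(ℝ × 𝕋; ℂ)`. -/
def liftMode (n : ℤ) (h : LineL2) : L2 ℂ := (memLp_mul_fourier n h).toLp

theorem mode_liftMode (n m : ℤ) (h : LineL2) :
    mode (liftMode n h) m = if m = n then h else 0 := by
  have key : ∀ᵐ x : ℝ, modeFun (liftMode n h) m x = h x * (Pi.single n 1 : ℤ → ℂ) m := by
    filter_upwards [ae_section_of_ae (memLp_mul_fourier n h).coeFn_toLp] with x hx
    rw [modeFun, ← fourierCoeff_fourier (T := 2 * Real.pi), ← fourierCoeff.const_mul]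
    refine congrFun (fourierCoeff_congr_ae ?_) m
    filter_upwards [hx] with y hy
    change RCLike.map ℂ ℂ ((memLp_mul_fourier n h).toLp _ (x, y)) = _
    rw [hy]
    apply Complex.ext <;> simp
  refine Lp.ext ?_
  filter_upwards [key, (memLp_modeFun (liftMode n h) m).coeFn_toLp,
    Lp.coeFn_zero ℂ 2 (volume : Measure ℝ)] with x h1 h2 h3
  rw [mode, h2, h1]
  split_ifs with hmn
  · simp [hmn]
  · rw [h3]; simp [hmn]

theorem mode_sum_liftMode (h : ℤ → LineL2) (s : Finset ℤ) (m : ℤ) :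
    mode (∑ n ∈ s, liftMode n (h n)) m = if m ∈ s then h m else 0 := by
  rw [← modeHom_apply, map_sum]
  simp only [modeHom_apply, mode_liftMode]
  rw [Finset.sum_ite_eq]

theorem norm_sum_liftMode_sq (h : ℤ → LineL2) (s : Finset ℤ) :
    ‖∑ n ∈ s, liftMode n (h n)‖ ^ 2 = 2 * Real.pi * ∑ n ∈ s, ‖h n‖ ^ 2 := by
  have h1 := hasSum_norm_mode_sq (∑ n ∈ s, liftMode n (h n))
  refine h1.unique ?_
  rw [Finset.mul_sum]
  have h2 : HasSum (fun m => 2 * Real.pi * ‖mode (∑ n ∈ s, liftMode n (h n)) m‖ ^ 2) _ :=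
    hasSum_sum_of_ne_finset_zero (s := s) fun m hm => by
      rw [mode_sum_liftMode, if_neg hm]; simp
  convert h2 using 1
  refine Finset.sum_congr rfl fun m hm => ?_
  rw [mode_sum_liftMode, if_pos hm]

/-- Every square-summable sequence is the sequence of modes of an element of `L²`. -/
theorem exists_mode_eq {h : ℤ → LineL2} (hs : Summable fun n => ‖h n‖ ^ 2) :
    ∃ U : L2 ℂ, ∀ n, mode U n = h n := by
  have hsum : Summable fun n => liftMode n (h n) := by
    rw [summable_iff_vanishing_norm]
    intro ε hε
    obtain ⟨s, hs⟩ := summable_iff_vanishing_norm.1 hs (ε ^ 2 / (2 * Real.pi)) (by positivity)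
    refine ⟨s, fun t ht => ?_⟩
    refine lt_of_pow_lt_pow_left₀ 2 hε.le ?_
    rw [norm_sum_liftMode_sq]
    have h1 := (le_abs_self _).trans_lt (hs t ht)
    rwa [lt_div_iff₀ Real.two_pi_pos, mul_comm] at h1
  refine ⟨∑' n, liftMode n (h n), fun m => ?_⟩
  have h1 := hsum.hasSum.map (modeHom m) (continuous_mode m)
  refine h1.unique ?_
  have h2 : HasSum (modeHom m ∘ fun n => liftMode n (h n)) _ := hasSum_single m fun n hn => by
    rw [Function.comp_apply, modeHom_apply, mode_liftMode, if_neg hn.symm]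
  rwa [Function.comp_apply, modeHom_apply, mode_liftMode, if_pos rfl] at h2

end Synthesis

/-! ### Complex conjugation and the Fourier transform. -/

section Conjugation

open SchwartzMap ComplexConjugate

/-- `η ↦ conj f(-η)`. -/
def conjNeg (f : LineL2) : LineL2 :=
  star (Lp.compMeasurePreserving Neg.neg (Measure.measurePreserving_neg volume) f)

theorem coeFn_conjNeg (f : LineL2) : conjNeg f =ᵐ[volume] fun η => conj (f (-η)) := by
  filter_upwards [Lp.coeFn_star
    (Lp.compMeasurePreserving Neg.neg (Measure.measurePreserving_neg volume) f),
    Lp.coeFn_compMeasurePreserving f (Measure.measurePreserving_neg (volume : Measure ℝ))]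
    with η h1 h2
  rw [conjNeg, h1, Pi.star_apply, h2]
  rfl

theorem continuous_star_lp {α : Type*} [MeasurableSpace α] {μ : Measure α} :
    Continuous fun f : Lp ℂ 2 μ => star f := by
  refine ((Complex.conjCLE : ℂ →L[ℝ] ℂ).compLpL 2 μ).continuous.congr fun f => Lp.ext ?_
  filter_upwards [Lp.coeFn_star f, (Complex.conjCLE : ℂ →L[ℝ] ℂ).coeFn_compLpL f] with x h1 h2
  rw [h1, h2]
  rfl

theorem continuous_conjNeg : Continuous conjNeg :=
  continuous_star_lp.comp
    (Lp.isometry_compMeasurePreserving (Measure.measurePreserving_neg volume)).continuous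

theorem fourier_star (f : LineL2) : (𝓕 (star f) : LineL2) = conjNeg (𝓕 f) := by
  refine (SchwartzMap.denseRange_toLpCLM (p := 2) ENNReal.ofNat_ne_top (F := ℂ) (E := ℝ)
    (μ := volume)).induction_on (p := fun f : LineL2 => (𝓕 (star f) : LineL2) = conjNeg (𝓕 f)) f
    (isClosed_eq ?_ ?_) fun s => ?_
  · exact (Lp.fourierTransformₗᵢ ℝ ℂ).continuous.comp continuous_star_lp
  · exact continuous_conjNeg.comp (Lp.fourierTransformₗᵢ ℝ ℂ).continuous
  change (𝓕 (star (s.toLp 2 : LineL2)) : LineL2) = conjNeg (𝓕 (s.toLp 2 : LineL2))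
  let r : 𝓢(ℝ, ℂ) := s.postcompCLM (𝕜 := ℝ) (Complex.conjCLE : ℂ →L[ℝ] ℂ)
  have hr : star (s.toLp 2 : LineL2) = r.toLp 2 := by
    refine Lp.ext ?_
    filter_upwards [Lp.coeFn_star (s.toLp 2 : LineL2), SchwartzMap.coeFn_toLp s 2 volume,
      SchwartzMap.coeFn_toLp r 2 volume] with x h1 h2 h3
    rw [h1, h3, Pi.star_apply, h2]
    rfl
  rw [hr, SchwartzMap.toLp_fourier_eq, SchwartzMap.toLp_fourier_eq]
  refine Lp.ext ?_
  have hneg := (Measure.measurePreserving_neg (volume : Measure ℝ)).quasiMeasurePreserving.ae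
    (SchwartzMap.coeFn_toLp (𝓕 s) 2 volume)
  filter_upwards [coeFn_conjNeg ((𝓕 s).toLp 2), SchwartzMap.coeFn_toLp (𝓕 r) 2 volume, hneg]
    with η h1 h2 h3
  rw [h1, h2, h3, SchwartzMap.fourier_coe, SchwartzMap.fourier_coe, Real.fourier_eq',
    Real.fourier_eq', ← integral_conj]
  refine integral_congr_ae (Filter.Eventually.of_forall fun x => ?_)
  have hrx : r x = conj (s x) := rfl
  simp only [hrx, smul_eq_mul, map_mul, ← Complex.exp_conj, Complex.conj_ofReal, Complex.conj_I]
  congr 2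
  simp

end Conjugation

/-! ### Fourier multipliers on real-valued and complex-valued functions. -/

section Hermitian

open ComplexConjugate

section Complexification

variable {𝕜 : Type*} [RCLike 𝕜]

/-- The complexification of an element of `L²(ℝ × 𝕋; 𝕜)`. -/
def toComplex (u : L2 𝕜) : L2 ℂ := (memLp_toComplexFun u).toLp

theorem map_complex_self (z : ℂ) : RCLike.map ℂ ℂ z = z := by
  apply Complex.ext <;> simp

theorem mode_toComplex (u : L2 𝕜) (n : ℤ) : mode (toComplex u) n = mode u n := by
  refine MemLp.toLp_congr _ _ ?_
  filter_upwards [ae_section_of_ae (memLp_toComplexFun u).coeFn_toLp] with x hx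
  refine congrFun (fourierCoeff_congr_ae ?_) n
  filter_upwards [hx] with y hy
  change RCLike.map ℂ ℂ ((memLp_toComplexFun u).toLp _ (x, y)) = _
  rw [hy, map_complex_self]

theorem memLp_map_complex (U : L2 ℂ) : MemLp (fun p => RCLike.map ℂ 𝕜 (U p)) 2 volume :=
  (RCLike.map ℂ 𝕜).comp_memLp' (Lp.memLp U)

variable (𝕜) in
/-- The projection of `L²(ℝ × 𝕋; ℂ)` on `L²(ℝ × 𝕋; 𝕜)`. -/
def ofComplex (U : L2 ℂ) : L2 𝕜 := (memLp_map_complex (𝕜 := 𝕜) U).toLp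

theorem coeFn_toComplex_ofComplex (U : L2 ℂ) :
    toComplex (ofComplex 𝕜 U) =ᵐ[volume] fun p => RCLike.map 𝕜 ℂ (RCLike.map ℂ 𝕜 (U p)) := by
  filter_upwards [(memLp_toComplexFun (ofComplex 𝕜 U)).coeFn_toLp,
    (memLp_map_complex (𝕜 := 𝕜) U).coeFn_toLp] with p h1 h2
  rw [toComplex, h1, toComplexFun, ofComplex, h2]

theorem ofComplex_toComplex (u : L2 𝕜) : ofComplex 𝕜 (toComplex u) = u := by
  refine Lp.ext ?_
  filter_upwards [(memLp_toComplexFun u).coeFn_toLp,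
    (memLp_map_complex (𝕜 := 𝕜) (toComplex u)).coeFn_toLp] with p h1 h2
  rw [ofComplex, h2, toComplex, h1, toComplexFun, RCLike.map_apply, RCLike.map_apply]
  simp [RCLike.re_add_im]

theorem mode_star (U : L2 ℂ) (n : ℤ) : mode (star U) n = star (mode U (-n)) := by
  refine Lp.ext ?_
  filter_upwards [(memLp_modeFun (star U) n).coeFn_toLp, (memLp_modeFun U (-n)).coeFn_toLp,
    Lp.coeFn_star (mode U (-n)), ae_section_of_ae (Lp.coeFn_star U)] with x h1 h2 h3 h4
  rw [mode, h1, h3, Pi.star_apply, mode, h2, modeFun, modeFun, fourierCoeff, fourierCoeff]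
  refine Eq.trans ?_ integral_conj
  refine integral_congr_ae ?_
  filter_upwards [h4] with y hy
  simp only [toComplexFun, map_complex_self, smul_eq_mul, map_mul]
  rw [hy, Pi.star_apply, neg_neg, fourier_neg]
  rfl

theorem uhat_star (U : L2 ℂ) (n : ℤ) : uhat (star U) n = conjNeg (uhat U (-n)) := by
  rw [uhat, mode_star, fourier_star, uhat]

theorem uhat_toComplex (u : L2 𝕜) (n : ℤ) : uhat (toComplex u) n = uhat u n := by
  rw [uhat, mode_toComplex, uhat]

theorem toComplex_ofComplex_of_im_I (hI : RCLike.im (RCLike.I : 𝕜) = 1) (U : L2 ℂ) :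
    toComplex (ofComplex 𝕜 U) = U := by
  refine Lp.ext ?_
  filter_upwards [coeFn_toComplex_ofComplex (𝕜 := 𝕜) U] with p hp
  rw [hp]
  apply Complex.ext <;> simp [hI]

theorem toComplex_ofComplex_of_star_eq (hI : (RCLike.I : 𝕜) = 0) {U : L2 ℂ} (hU : star U = U) :
    toComplex (ofComplex 𝕜 U) = U := by
  refine Lp.ext ?_
  have h := Lp.coeFn_star U
  rw [hU] at h
  filter_upwards [coeFn_toComplex_ofComplex (𝕜 := 𝕜) U, h] with p hp h1
  have h2 : (U p).im = 0 := by
    have := congrArg Complex.im h1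
    rw [Pi.star_apply] at this
    simp at this
    linarith
  rw [hp]
  apply Complex.ext
  · simp [hI]
  · simp [hI, h2]

theorem star_toComplex (hI : (RCLike.I : 𝕜) = 0) (u : L2 𝕜) :
    star (toComplex u) = toComplex u := by
  refine Lp.ext ?_
  filter_upwards [(memLp_toComplexFun u).coeFn_toLp, Lp.coeFn_star (toComplex u)] with p h1 h2
  rw [h2, Pi.star_apply, toComplex, h1, toComplexFun]
  have him : RCLike.im (u p) = 0 := by
    have := RCLike.mul_im_I_ax (u p)
    rw [hI] at this
    simpa using this.symm
  apply Complex.ext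
  · simp
  · simp [him]

end Complexification

section Multipliers

variable {𝕜 : Type*} [RCLike 𝕜]

/-- Measurable symbols that preserve real-valued functions. -/
structure IsHermitianSymbol (m : ℝ → ℤ → ℂ) : Prop where
  measurable : ∀ n, Measurable fun ξ => m ξ n
  conj_neg : ∀ ξ n, conj (m (-ξ) (-n)) = m ξ n

theorem IsHermitianSymbol.mul {m m' : ℝ → ℤ → ℂ} (h : IsHermitianSymbol m)
    (h' : IsHermitianSymbol m') : IsHermitianSymbol fun ξ n => m ξ n * m' ξ n :=
  ⟨fun n => (h.measurable n).mul (h'.measurable n), fun ξ n => by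
    rw [map_mul, h.conj_neg, h'.conj_neg]⟩

theorem IsHermitianSymbol.add {m m' : ℝ → ℤ → ℂ} (h : IsHermitianSymbol m)
    (h' : IsHermitianSymbol m') : IsHermitianSymbol fun ξ n => m ξ n + m' ξ n :=
  ⟨fun n => (h.measurable n).add (h'.measurable n), fun ξ n => by
    rw [map_add, h.conj_neg, h'.conj_neg]⟩

theorem IsHermitianSymbol.neg {m : ℝ → ℤ → ℂ} (h : IsHermitianSymbol m) :
    IsHermitianSymbol fun ξ n => -m ξ n :=
  ⟨fun n => (h.measurable n).neg, fun ξ n => by rw [map_neg, h.conj_neg]⟩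

theorem norm_uhat (u : L2 𝕜) (n : ℤ) : ‖uhat u n‖ = ‖mode u n‖ := Lp.norm_fourier_eq _

theorem summable_norm_mode_sq (u : L2 𝕜) : Summable fun n => ‖mode u n‖ ^ 2 :=
  (summable_mul_left_iff Real.two_pi_pos.ne').1 (hasSum_norm_mode_sq u).summable

theorem exists_complex_multiplierImage {m : ℝ → ℤ → ℂ} (hm : ∀ n, Measurable fun ξ => m ξ n)
    {C : ℝ} (hC : ∀ ξ n, ‖m ξ n‖ ≤ C) (u : L2 ℂ) : ∃ v, IsMultiplierImage m u v := by
  have hmeas : ∀ n, Measurable fun η : ℝ => m (2 * Real.pi * η) n := fun n =>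
    (hm n).comp (measurable_const.mul measurable_id)
  let T : ℤ → LineL2 := fun n => mulBdd (hmeas n) (fun η => hC (2 * Real.pi * η) n) (uhat u n)
  have hC0 : 0 ≤ C := (norm_nonneg _).trans (hC 0 0)
  have hs : Summable fun n => ‖(𝓕⁻ (T n) : LineL2)‖ ^ 2 := by
    refine Summable.of_nonneg_of_le (fun n => sq_nonneg _) (fun n => ?_)
      ((summable_norm_mode_sq u).mul_left (C ^ 2))
    have h1 : ‖(𝓕⁻ (T n) : LineL2)‖ = ‖T n‖ := (Lp.fourierTransformₗᵢ ℝ ℂ).symm.norm_map _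
    rw [h1, ← mul_pow, ← norm_uhat]
    exact pow_le_pow_left₀ (norm_nonneg _) (norm_mulBdd_le _ _ _) 2
  obtain ⟨v, hv⟩ := exists_mode_eq hs
  refine ⟨v, fun n => ?_⟩
  have h1 : uhat v n = T n := by
    rw [uhat, hv n]
    exact FourierTransform.fourier_fourierInv_eq _
  rw [h1]
  exact coeFn_mulBdd _ _ _

/-- Bounded Hermitian symbols define operators on `L²(ℝ × 𝕋; 𝕜)`. -/
theorem IsHermitianSymbol.exists_multiplierImage {m : ℝ → ℤ → ℂ} (hm : IsHermitianSymbol m)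
    {C : ℝ} (hC : ∀ ξ n, ‖m ξ n‖ ≤ C) (u : L2 𝕜) : ∃ v, IsMultiplierImage m u v := by
  obtain ⟨V, hV⟩ := exists_complex_multiplierImage hm.measurable hC (toComplex u)
  have hV' : toComplex (ofComplex 𝕜 V) = V := by
    rcases RCLike.I_eq_zero_or_im_I_eq_one (K := 𝕜) with hI | hI
    · refine toComplex_ofComplex_of_star_eq hI (IsMultiplierImage.unique (m := m)
        (u := toComplex u) (fun n => ?_) hV)
      have h1 := (Measure.measurePreserving_neg (volume : Measure ℝ)).quasiMeasurePreserving.ae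
        (hV (-n))
      have h2 := uhat_star (toComplex u) n
      rw [star_toComplex hI] at h2
      rw [uhat_star, h2]
      filter_upwards [h1, coeFn_conjNeg (uhat V (-n)), coeFn_conjNeg (uhat (toComplex u) (-n))]
        with η e1 e2 e3
      rw [e2, e3, e1, map_mul, mul_neg, hm.conj_neg]
    · exact toComplex_ofComplex_of_im_I hI V
  refine ⟨ofComplex 𝕜 V, fun n => ?_⟩
  have h1 := uhat_toComplex (ofComplex 𝕜 V) n
  rw [hV'] at h1
  rw [← h1, ← uhat_toComplex u]
  exact hV n

theorem IsMultiplierImage.of_mul {m m' : ℝ → ℤ → ℂ} {u v w : L2 𝕜} (h : IsMultiplierImage m u v)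
    (h' : IsMultiplierImage (fun ξ n => m' ξ n * m ξ n) u w) : IsMultiplierImage m' v w := by
  intro n
  filter_upwards [h n, h' n] with η h1 h2
  rw [h1, h2, mul_assoc]

/-- By Plancherel, the adjoint of a multiplier has the conjugate symbol; no boundedness is needed
once both images lie in `L²`. -/
theorem IsMultiplierImage.re_inner_eq {m m' : ℝ → ℤ → ℂ} (hm : ∀ ξ n, conj (m ξ n) = m' ξ n)
    {u u' v v' : L2 𝕜} (hu : IsMultiplierImage m u u') (hv : IsMultiplierImage m' v v') :
    RCLike.re (inner 𝕜 u' v) = RCLike.re (inner 𝕜 u v') := by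
  refine (hasSum_re_inner_mode u' v).unique ?_
  have he : (fun n => 2 * Real.pi * (inner ℂ (mode u' n) (mode v n)).re) =
      fun n => 2 * Real.pi * (inner ℂ (mode u n) (mode v' n)).re := by
    funext n
    rw [← Lp.inner_fourier_eq (mode u' n), ← Lp.inner_fourier_eq (mode u n), L2.inner_def,
      L2.inner_def]
    congr 2
    refine integral_congr_ae ?_
    filter_upwards [hu n, hv n] with η h1 h2
    change inner ℂ (uhat u' n η) (uhat v n η) = inner ℂ (uhat u n η) (uhat v' n η)
    rw [h1, h2, ← hm]
    simp only [RCLike.inner_apply, map_mul]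
    ring
  rw [he]
  exact hasSum_re_inner_mode u v'

end Multipliers

section Symbols

theorem isHermitianSymbol_dx : IsHermitianSymbol symbolDx :=
  ⟨fun n => by unfold symbolDx; fun_prop, fun ξ n => by simp [symbolDx]⟩

theorem isHermitianSymbol_dxInvDy : IsHermitianSymbol symbolDxInvDy :=
  ⟨fun n => by unfold symbolDxInvDy; fun_prop, fun ξ n => by simp [symbolDxInvDy]⟩

/-- The symbol of `-∂_x + ∂_x⁻¹∂_y`. -/
def fwdSymbol (ξ : ℝ) (n : ℤ) : ℂ := -symbolDx ξ n + symbolDxInvDy ξ n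

/-- The symbol of `∂_x + ∂_x⁻¹∂_y`. -/
def adjSymbol (ξ : ℝ) (n : ℤ) : ℂ := symbolDx ξ n + symbolDxInvDy ξ n

theorem isHermitianSymbol_fwd : IsHermitianSymbol fwdSymbol :=
  isHermitianSymbol_dx.neg.add isHermitianSymbol_dxInvDy

theorem isHermitianSymbol_adj : IsHermitianSymbol adjSymbol :=
  isHermitianSymbol_dx.add isHermitianSymbol_dxInvDy

theorem conj_symbolDx (ξ : ℝ) (n : ℤ) : conj (symbolDx ξ n) = -symbolDx ξ n := by
  simp [symbolDx]

theorem symbolDxInvDy_eq (ξ : ℝ) (n : ℤ) : symbolDxInvDy ξ n = ((n / ξ : ℝ) : ℂ) := by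
  rw [symbolDxInvDy]
  rcases eq_or_ne ξ 0 with rfl | h
  · simp
  · have : (ξ : ℂ) ≠ 0 := by exact_mod_cast h
    have hI := Complex.I_ne_zero
    push_cast
    field_simp

theorem conj_fwdSymbol (ξ : ℝ) (n : ℤ) : conj (fwdSymbol ξ n) = adjSymbol ξ n := by
  rw [fwdSymbol, adjSymbol, map_add, map_neg, conj_symbolDx, symbolDxInvDy_eq,
    Complex.conj_ofReal, neg_neg]

theorem conj_adjSymbol (ξ : ℝ) (n : ℤ) : conj (adjSymbol ξ n) = fwdSymbol ξ n := by
  rw [← conj_fwdSymbol, Complex.conj_conj]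

theorem norm_symbolDx_sq (ξ : ℝ) (n : ℤ) : ‖symbolDx ξ n‖ ^ 2 = ξ ^ 2 := by
  simp [symbolDx]

theorem norm_symbolDxInvDy_sq (ξ : ℝ) (n : ℤ) : ‖symbolDxInvDy ξ n‖ ^ 2 = (n / ξ) ^ 2 := by
  rw [symbolDxInvDy_eq, Complex.norm_real, Real.norm_eq_abs, sq_abs]

theorem adjSymbol_mul_fwdSymbol (ξ : ℝ) (n : ℤ) :
    adjSymbol ξ n * fwdSymbol ξ n = ((ξ ^ 2 + (n / ξ) ^ 2 : ℝ) : ℂ) := by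
  rw [adjSymbol, fwdSymbol, symbolDxInvDy_eq, symbolDx]
  push_cast
  linear_combination (-(ξ : ℂ) ^ 2) * Complex.I_sq

theorem norm_fwdSymbol_sq (ξ : ℝ) (n : ℤ) : ‖fwdSymbol ξ n‖ ^ 2 = ξ ^ 2 + (n / ξ) ^ 2 := by
  have h := Complex.conj_mul' (fwdSymbol ξ n)
  rw [conj_fwdSymbol, adjSymbol_mul_fwdSymbol] at h
  exact_mod_cast h.symm

theorem norm_adjSymbol_sq (ξ : ℝ) (n : ℤ) : ‖adjSymbol ξ n‖ ^ 2 = ξ ^ 2 + (n / ξ) ^ 2 := by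
  rw [← conj_fwdSymbol, RCLike.norm_conj, norm_fwdSymbol_sq]

/-- The symbol of the resolvent `(1 + |σ|²)⁻¹`, where `σ` is `fwdSymbol`. -/
def resolventSymbol (ξ : ℝ) (n : ℤ) : ℂ := (((1 + ξ ^ 2 + (n / ξ) ^ 2)⁻¹ : ℝ) : ℂ)

theorem isHermitianSymbol_resolvent : IsHermitianSymbol resolventSymbol := by
  refine ⟨fun n => by unfold resolventSymbol; fun_prop, fun ξ n => ?_⟩
  rw [resolventSymbol, Complex.conj_ofReal, resolventSymbol]
  push_cast
  simp

theorem conj_resolventSymbol (ξ : ℝ) (n : ℤ) :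
    conj (resolventSymbol ξ n) = resolventSymbol ξ n := Complex.conj_ofReal _

theorem resolventSymbol_mul (ξ : ℝ) (n : ℤ) :
    (1 + adjSymbol ξ n * fwdSymbol ξ n) * resolventSymbol ξ n = 1 := by
  rw [adjSymbol_mul_fwdSymbol, resolventSymbol]
  have h : (1 + (ξ ^ 2 + (n / ξ) ^ 2)) * (1 + ξ ^ 2 + (n / ξ) ^ 2)⁻¹ = (1 : ℝ) := by
    rw [← add_assoc]; exact mul_inv_cancel₀ (by positivity)
  exact_mod_cast h

/-- `‖z‖‖w‖ ≤ (‖z‖² + ‖w‖²)/2`. The resolvent thus gains two factors of order `|σ|`: one is spent on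
the symbol applied to the data, the other on membership in `𝓔`. -/
theorem norm_mul_mul_resolventSymbol_le {z w : ℂ} {ξ : ℝ} {n : ℤ}
    (hz : ‖z‖ ^ 2 ≤ 1 + ξ ^ 2 + (n / ξ) ^ 2) (hw : ‖w‖ ^ 2 ≤ 1 + ξ ^ 2 + (n / ξ) ^ 2) :
    ‖z * (w * resolventSymbol ξ n)‖ ≤ 1 := by
  have hpos : 0 < 1 + ξ ^ 2 + (n / ξ) ^ 2 := by positivity
  rw [norm_mul, norm_mul, resolventSymbol, Complex.norm_real, norm_inv,
    Real.norm_of_nonneg hpos.le, ← mul_assoc, ← div_eq_mul_inv, div_le_one hpos]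
  nlinarith [sq_nonneg (‖z‖ - ‖w‖)]

end Symbols

end Hermitian

/-! ### Weak solutions belong to the energy space. -/

section WeakSolutions

open ComplexConjugate

section Regularity

variable {𝕜 : Type*} [RCLike 𝕜]

/-- The element of `𝓔` with given `u`, `∂_x u` and `∂_x⁻¹∂_y u`. -/
def energyMk {u d a : L2 𝕜} (hd : IsMultiplierImage symbolDx u d)
    (ha : IsMultiplierImage symbolDxInvDy u a) : EnergySpace 𝕜 :=
  (⟨u, ⟨d, hd⟩, a, ha⟩ : ↥(energySubmodule 𝕜))

variable {u d a : L2 𝕜} (hd : IsMultiplierImage symbolDx u d)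
  (ha : IsMultiplierImage symbolDxInvDy u a)

theorem incl_energyMk : EnergySpace.incl 𝕜 (energyMk hd ha) = u := rfl

theorem dx_energyMk : EnergySpace.dx 𝕜 (energyMk hd ha) = d :=
  (EnergySpace.dxₗ_spec 𝕜 (energyMk hd ha)).unique hd

theorem dxInvDy_energyMk : EnergySpace.dxInvDy 𝕜 (energyMk hd ha) = a :=
  (EnergySpace.dxInvDyₗ_spec 𝕜 (energyMk hd ha)).unique ha

theorem dx_spec (g : EnergySpace 𝕜) :
    IsMultiplierImage symbolDx (EnergySpace.incl 𝕜 g) (EnergySpace.dx 𝕜 g) :=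
  EnergySpace.dxₗ_spec 𝕜 g

theorem dxInvDy_spec (g : EnergySpace 𝕜) :
    IsMultiplierImage symbolDxInvDy (EnergySpace.incl 𝕜 g) (EnergySpace.dxInvDy 𝕜 g) :=
  EnergySpace.dxInvDyₗ_spec 𝕜 g

theorem IsMultiplierImage.add_symbol {m m' : ℝ → ℤ → ℂ} {u v w : L2 𝕜}
    (h : IsMultiplierImage m u v) (h' : IsMultiplierImage m' u w) :
    IsMultiplierImage (fun ξ n => m ξ n + m' ξ n) u (v + w) := by
  intro n
  rw [uhat_add]
  filter_upwards [h n, h' n, Lp.coeFn_add (uhat v n) (uhat w n)] with η h1 h2 h3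
  rw [h3, Pi.add_apply, h1, h2, add_mul]

theorem IsMultiplierImage.of_resolvent {m : ℝ → ℤ → ℂ}
    (hm : IsHermitianSymbol m) (hm' : ∀ ξ n, ‖m ξ n‖ ^ 2 ≤ 1 + ξ ^ 2 + (n / ξ) ^ 2)
    {m' : ℝ → ℤ → ℂ} (hr : IsHermitianSymbol m')
    (hr' : ∀ ξ n, ‖m' ξ n‖ ^ 2 ≤ 1 + ξ ^ 2 + (n / ξ) ^ 2) {u v : L2 𝕜}
    (h : IsMultiplierImage (fun ξ n => m' ξ n * resolventSymbol ξ n) u v) :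
    ∃ w, IsMultiplierImage m v w := by
  obtain ⟨w, hw⟩ := (hm.mul (hr.mul isHermitianSymbol_resolvent)).exists_multiplierImage
    (fun ξ n => norm_mul_mul_resolventSymbol_le (hm' ξ n) (hr' ξ n)) u
  exact ⟨w, h.of_mul hw⟩

theorem isHermitianSymbol_one : IsHermitianSymbol fun _ _ => 1 :=
  ⟨fun _ => measurable_const, fun _ _ => map_one _⟩

theorem norm_one_sq_le (ξ : ℝ) (n : ℤ) : ‖(1 : ℂ)‖ ^ 2 ≤ 1 + ξ ^ 2 + ((n : ℝ) / ξ) ^ 2 := by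
  rw [norm_one]; nlinarith [sq_nonneg ξ, sq_nonneg ((n : ℝ) / ξ)]

/-- For a symbol `m` of size at most `(1 + |σ|²)^{1/2}` the operator `m (1 + |σ|²)⁻¹` maps
`L²` to `𝓔`. -/
theorem exists_resolvent_image {m : ℝ → ℤ → ℂ} (hm : IsHermitianSymbol m)
    (hm' : ∀ ξ n, ‖m ξ n‖ ^ 2 ≤ 1 + ξ ^ 2 + (n / ξ) ^ 2) (u : L2 𝕜) :
    ∃ g : EnergySpace 𝕜, IsMultiplierImage (fun ξ n => m ξ n * resolventSymbol ξ n) u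
      (EnergySpace.incl 𝕜 g) := by
  obtain ⟨v, hv⟩ := (isHermitianSymbol_one.mul (hm.mul
    isHermitianSymbol_resolvent)).exists_multiplierImage
    (fun ξ n => norm_mul_mul_resolventSymbol_le (norm_one_sq_le ξ n) (hm' ξ n)) u
  simp only [one_mul] at hv
  obtain ⟨d, hd⟩ := IsMultiplierImage.of_resolvent isHermitianSymbol_dx (fun ξ n => by
    rw [norm_symbolDx_sq]; nlinarith [sq_nonneg (n / ξ)]) hm hm' hv
  obtain ⟨a, ha⟩ := IsMultiplierImage.of_resolvent isHermitianSymbol_dxInvDy (fun ξ n => by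
    rw [norm_symbolDxInvDy_sq]; nlinarith [sq_nonneg ξ]) hm hm' hv
  exact ⟨energyMk hd ha, hv⟩

/-- The adjoint of `∂_x + ∂_x⁻¹∂_y` with domain `𝓔` is `-∂_x + ∂_x⁻¹∂_y` with domain `𝓔`. -/
theorem exists_energy_of_weak {u w : L2 𝕜}
    (h : ∀ g : EnergySpace 𝕜,
      RCLike.re (inner 𝕜 u (EnergySpace.dx 𝕜 g + EnergySpace.dxInvDy 𝕜 g)) =
        RCLike.re (inner 𝕜 w (EnergySpace.incl 𝕜 g))) :
    ∃ U : EnergySpace 𝕜, EnergySpace.incl 𝕜 U = u ∧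
      -EnergySpace.dx 𝕜 U + EnergySpace.dxInvDy 𝕜 U = w := by
  -- With `A`, `σ = conj A` and `R` the adjoint, forward and resolvent symbols, `w = σu` would give
  -- `u = R(1 + Aσ)u = Ru + RAw`. The right side is in `𝓔` for any `u` and `w` in `L²`.
  obtain ⟨g₁, hg₁⟩ := exists_resolvent_image isHermitianSymbol_one norm_one_sq_le u
  obtain ⟨g₂, hg₂⟩ := exists_resolvent_image isHermitianSymbol_adj (fun ξ n => by
    rw [norm_adjSymbol_sq]; linarith) w
  have hu : EnergySpace.incl 𝕜 (g₁ + g₂) = u := by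
    rw [← sub_eq_zero, ← inner_self_eq_zero (𝕜 := 𝕜)]
    set φ := EnergySpace.incl 𝕜 (g₁ + g₂) - u with hφ
    -- Moving the multipliers onto `φ` gives `k₁ = Rφ` and `k₂ = Rσφ`; the weak equation with test
    -- function `k₂` turns `⟪w, k₂⟫` into `⟪u, AσRφ⟫`. Since `Rφ + AσRφ = φ`, the terms cancel.
    obtain ⟨k₁, hk₁⟩ := exists_resolvent_image isHermitianSymbol_one norm_one_sq_le φ
    obtain ⟨k₂, hk₂⟩ := exists_resolvent_image isHermitianSymbol_fwd (fun ξ n => by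
      rw [norm_fwdSymbol_sq]; linarith) φ
    have e1 := hg₁.re_inner_eq (m' := fun ξ n => 1 * resolventSymbol ξ n)
      (fun ξ n => by rw [map_mul, map_one, conj_resolventSymbol]) hk₁
    have e2 := hg₂.re_inner_eq (m' := fun ξ n => fwdSymbol ξ n * resolventSymbol ξ n)
      (fun ξ n => by rw [map_mul, conj_adjSymbol, conj_resolventSymbol]) hk₂
    have e3 : EnergySpace.incl 𝕜 k₁ + (EnergySpace.dx 𝕜 k₂ + EnergySpace.dxInvDy 𝕜 k₂) = φ := by
      refine ext_uhat fun n => Lp.ext ?_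
      rw [uhat_add]
      filter_upwards [hk₁ n, hk₂ n, ((dx_spec k₂).add_symbol (dxInvDy_spec k₂)) n,
        Lp.coeFn_add (uhat (EnergySpace.incl 𝕜 k₁) n)
          (uhat (EnergySpace.dx 𝕜 k₂ + EnergySpace.dxInvDy 𝕜 k₂) n)] with η f1 f2 f3 f4
      rw [f4, Pi.add_apply, f3, f2, f1]
      have := resolventSymbol_mul (2 * Real.pi * η) n
      rw [adjSymbol] at this
      linear_combination (uhat φ n η) * this
    have e4 := h k₂
    have e5 : RCLike.re (inner 𝕜 φ φ) = 0 := by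
      have e7 : ∀ ψ, RCLike.re (inner 𝕜 φ ψ) = RCLike.re (inner 𝕜 (EnergySpace.incl 𝕜 g₁) ψ) +
          RCLike.re (inner 𝕜 (EnergySpace.incl 𝕜 g₂) ψ) - RCLike.re (inner 𝕜 u ψ) := fun ψ => by
        rw [hφ, inner_sub_left, map_add, inner_add_left, map_sub, map_add]
      rw [e7, e1, e2, ← e4, ← map_add, ← inner_add_right, e3, sub_self]
    have e6 := inner_self_im (𝕜 := 𝕜) φ
    exact RCLike.ext (by rw [e5, map_zero]) (by rw [e6, map_zero])
  refine ⟨g₁ + g₂, hu, ext_uhat fun n => Lp.ext ?_⟩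
  have hneg : IsMultiplierImage (fun ξ n => -symbolDx ξ n) (EnergySpace.incl 𝕜 (g₁ + g₂))
      (-EnergySpace.dx 𝕜 (g₁ + g₂)) := by
    intro n
    have h1 : uhat (-EnergySpace.dx 𝕜 (g₁ + g₂)) n = -uhat (EnergySpace.dx 𝕜 (g₁ + g₂)) n := by
      rw [uhat, mode_neg]
      exact map_neg (Lp.fourierTransformₗᵢ ℝ ℂ) _
    rw [h1]
    filter_upwards [dx_spec (g₁ + g₂) n, Lp.coeFn_neg (uhat (EnergySpace.dx 𝕜 (g₁ + g₂)) n)]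
      with η f1 f2
    rw [f2, Pi.neg_apply, f1, neg_mul]
  have hadd : uhat u n = uhat (EnergySpace.incl 𝕜 g₁) n + uhat (EnergySpace.incl 𝕜 g₂) n := by
    rw [← hu, map_add, uhat_add]
  have hfwd := (hneg.add_symbol (dxInvDy_spec (g₁ + g₂))) n
  rw [hu, hadd] at hfwd
  have hadd' := Lp.coeFn_add (uhat (EnergySpace.incl 𝕜 g₁) n) (uhat (EnergySpace.incl 𝕜 g₂) n)
  have hadd2 := hadd'
  rw [← hadd] at hadd2
  filter_upwards [hfwd, hg₁ n, hg₂ n, hadd', hadd2, ae_ne_zero] with η f1 f2 f3 f4 f4' f5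
  rw [f1, f4, Pi.add_apply, f2, f3]
  have hU := f4'
  rw [Pi.add_apply, f2, f3] at hU
  have hr := resolventSymbol_mul (2 * Real.pi * η) n
  have hne : adjSymbol (2 * Real.pi * η) n ≠ 0 := by
    rw [← norm_ne_zero_iff, ← sq_pos_iff, norm_adjSymbol_sq]
    have : 2 * Real.pi * η ≠ 0 := mul_ne_zero Real.two_pi_pos.ne' f5
    positivity
  have hrne : resolventSymbol (2 * Real.pi * η) n ≠ 0 := right_ne_zero_of_mul_eq_one hr
  rw [← fwdSymbol]
  set S := fwdSymbol (2 * Real.pi * η) n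
  set A := adjSymbol (2 * Real.pi * η) n
  set R := resolventSymbol (2 * Real.pi * η) n
  set x := uhat u n η
  set y := uhat w n η
  have h1 : S * x = y := by
    -- The identity `x = Rx + ARy` only gives `Sx = y` after division by `RA`, which is nonzero off
    -- the null set `ξ = 0`.
    have : R * A * (S * x - y) = 0 := by linear_combination x * hr + hU
    have h2 := (mul_eq_zero.1 this).resolve_left (mul_ne_zero hrne hne)
    exact sub_eq_zero.1 h2
  rw [← hU, h1]

end Regularity

end WeakSolutions

/-! ### The operator `𝓛_c`: completeness of `𝓔`, surjectivity, kernel. -/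

section LinearizedOperator

open ComplexConjugate

variable {𝕜 : Type*} [RCLike 𝕜]

section Completeness

/-- The graph of a multiplier is closed: along a common subsequence both Fourier transforms converge
a.e., and the pointwise relation passes to the limit. -/
theorem IsMultiplierImage.of_tendsto {m : ℝ → ℤ → ℂ} {u v : ℕ → L2 𝕜} {u₀ v₀ : L2 𝕜}
    (h : ∀ j, IsMultiplierImage m (u j) (v j)) (hu : Filter.Tendsto u Filter.atTop (nhds u₀))
    (hv : Filter.Tendsto v Filter.atTop (nhds v₀)) : IsMultiplierImage m u₀ v₀ := by
  intro n
  have hcont : Continuous fun w : L2 𝕜 => uhat w n :=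
    (Lp.fourierTransformₗᵢ ℝ ℂ).continuous.comp (continuous_mode n)
  obtain ⟨ns, hns, hns'⟩ := (tendstoInMeasure_of_tendsto_Lp
    ((hcont.tendsto u₀).comp hu)).exists_seq_tendsto_ae
  have hall : ∀ᵐ η : ℝ, ∀ j, uhat (v j) n η = m (2 * Real.pi * η) n * uhat (u j) n η :=
    ae_all_iff.2 fun j => h j n
  obtain ⟨ks, hks, hks'⟩ := (tendstoInMeasure_of_tendsto_Lp
    (((hcont.tendsto v₀).comp hv).comp hns.tendsto_atTop)).exists_seq_tendsto_ae
  filter_upwards [hns', hks', hall] with η h1 h2 h3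
  refine tendsto_nhds_unique h2 ?_
  refine ((h1.comp hks.tendsto_atTop).const_mul (m (2 * Real.pi * η) n)).congr fun i => ?_
  exact (h3 _).symm

theorem energy_norm_sq (g : EnergySpace 𝕜) :
    ‖g‖ ^ 2 = ‖EnergySpace.incl 𝕜 g‖ ^ 2 + ‖EnergySpace.dx 𝕜 g‖ ^ 2 +
      ‖EnergySpace.dxInvDy 𝕜 g‖ ^ 2 := EnergySpace.norm_sq_eq 𝕜 g

/-- Needed for the closed range of `opAdj` and for the open mapping theorem applied to `𝓛_c`. -/
instance instCompleteSpaceEnergySpace : CompleteSpace (EnergySpace 𝕜) := by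
  refine Metric.complete_of_cauchySeq_tendsto fun g hg => ?_
  obtain ⟨u, hu⟩ := cauchySeq_tendsto_of_complete
    ((EnergySpace.incl 𝕜).uniformContinuous.comp_cauchySeq hg)
  obtain ⟨d, hd⟩ := cauchySeq_tendsto_of_complete
    ((EnergySpace.dx 𝕜).uniformContinuous.comp_cauchySeq hg)
  obtain ⟨a, ha⟩ := cauchySeq_tendsto_of_complete
    ((EnergySpace.dxInvDy 𝕜).uniformContinuous.comp_cauchySeq hg)
  have h1 := IsMultiplierImage.of_tendsto (fun j => dx_spec (g j)) hu hd
  have h2 := IsMultiplierImage.of_tendsto (fun j => dxInvDy_spec (g j)) hu ha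
  refine ⟨energyMk h1 h2, tendsto_iff_norm_sub_tendsto_zero.2 ?_⟩
  have h3 : Filter.Tendsto (fun j => √(‖EnergySpace.incl 𝕜 (g j) - u‖ ^ 2 +
      ‖EnergySpace.dx 𝕜 (g j) - d‖ ^ 2 + ‖EnergySpace.dxInvDy 𝕜 (g j) - a‖ ^ 2))
      Filter.atTop (nhds 0) := by
    have e1 := ((tendsto_iff_norm_sub_tendsto_zero.1 hu).pow 2).add
      ((tendsto_iff_norm_sub_tendsto_zero.1 hd).pow 2) |>.add
      ((tendsto_iff_norm_sub_tendsto_zero.1 ha).pow 2) |>.sqrt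
    simpa using e1
  refine h3.congr fun j => ?_
  rw [← Real.sqrt_sq (norm_nonneg (g j - energyMk h1 h2)), energy_norm_sq]
  simp only [map_sub, incl_energyMk, dx_energyMk, dxInvDy_energyMk]

end Completeness

section Adjoint

variable (𝕜) in
/-- The formal adjoint `∂_x + ∂_x⁻¹∂_y - 2 Q_c` of `𝓛_c`. -/
def opAdj (c : ℝ) : EnergySpace 𝕜 →L[𝕜] L2 𝕜 :=
  EnergySpace.dx 𝕜 + EnergySpace.dxInvDy 𝕜
    - (2 : 𝕜) • (mulKink 𝕜 c).comp (EnergySpace.incl 𝕜)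

theorem opAdj_apply (c : ℝ) (g : EnergySpace 𝕜) : opAdj 𝕜 c g = EnergySpace.dx 𝕜 g +
    EnergySpace.dxInvDy 𝕜 g - (2 : 𝕜) • mulKink 𝕜 c (EnergySpace.incl 𝕜 g) := rfl

theorem opL_apply (c : ℝ) (g : EnergySpace 𝕜) : opL 𝕜 c g = -EnergySpace.dx 𝕜 g +
    EnergySpace.dxInvDy 𝕜 g - (2 : 𝕜) • mulKink 𝕜 c (EnergySpace.incl 𝕜 g) := rfl

theorem isDeriv_mode (g : EnergySpace 𝕜) (n : ℤ) :
    IsDeriv (mode (EnergySpace.incl 𝕜 g) n) (mode (EnergySpace.dx 𝕜 g) n) := dx_spec g n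

theorem isDerivInv_mode (g : EnergySpace 𝕜) (n : ℤ) :
    IsDerivInv n (mode (EnergySpace.incl 𝕜 g) n) (mode (EnergySpace.dxInvDy 𝕜 g) n) :=
  dxInvDy_spec g n

theorem mode_opAdj (c : ℝ) (g : EnergySpace 𝕜) (n : ℤ) :
    mode (opAdj 𝕜 c g) n = mode (EnergySpace.dx 𝕜 g) n + mode (EnergySpace.dxInvDy 𝕜 g) n -
      (2 : ℂ) • lineKink c (mode (EnergySpace.incl 𝕜 g) n) := by
  rw [opAdj_apply, mode_sub, mode_add, mode_two_smul, mode_mulKink]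

theorem mode_opL (c : ℝ) (g : EnergySpace 𝕜) (n : ℤ) :
    mode (opL 𝕜 c g) n = -mode (EnergySpace.dx 𝕜 g) n + mode (EnergySpace.dxInvDy 𝕜 g) n -
      (2 : ℂ) • lineKink c (mode (EnergySpace.incl 𝕜 g) n) := by
  rw [opL_apply, mode_sub, mode_add, mode_neg, mode_two_smul, mode_mulKink]

theorem norm_sq_le_opAdj {c : ℝ} (hc : 0 < c) (g : EnergySpace 𝕜) :
    ‖g‖ ^ 2 ≤ coercConst c * ‖opAdj 𝕜 c g‖ ^ 2 := by
  rw [energy_norm_sq]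
  refine hasSum_le (fun n => ?_) (((hasSum_norm_mode_sq (EnergySpace.incl 𝕜 g)).add
    (hasSum_norm_mode_sq (EnergySpace.dx 𝕜 g))).add
    (hasSum_norm_mode_sq (EnergySpace.dxInvDy 𝕜 g)))
    ((hasSum_norm_mode_sq (opAdj 𝕜 c g)).mul_left (coercConst c))
  have h := adjoint_mode_lower_bound hc (isDeriv_mode g n) (isDerivInv_mode g n)
  rw [← mode_opAdj] at h
  nlinarith [Real.two_pi_pos]

theorem antilipschitz_opAdj {c : ℝ} (hc : 0 < c) :
    AntilipschitzWith (√(coercConst c)).toNNReal (opAdj 𝕜 c) := by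
  refine (opAdj 𝕜 c).antilipschitz_of_bound fun g => ?_
  rw [Real.coe_toNNReal _ (Real.sqrt_nonneg _)]
  refine le_of_sq_le_sq ?_ (by positivity)
  rw [mul_pow, Real.sq_sqrt (coercConst_pos hc).le]
  exact norm_sq_le_opAdj hc g

/-- Because `opAdj` is bounded below, `opAdj g ↦ ⟪h, g⟫` is a well-defined bounded functional on its
closed range, and Riesz represents it there. -/
theorem exists_inner_opAdj_eq {c : ℝ} (hc : 0 < c) (h : L2 𝕜) :
    ∃ u : L2 𝕜, ∀ g, inner 𝕜 u (opAdj 𝕜 c g) = inner 𝕜 h (EnergySpace.incl 𝕜 g) := by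
  have hanti := antilipschitz_opAdj (𝕜 := 𝕜) hc
  have hclosed := hanti.isClosed_range (opAdj 𝕜 c).uniformContinuous
  let e := (opAdj 𝕜 c).equivRange hanti.injective hclosed
  have : CompleteSpace (opAdj 𝕜 c).range := hclosed.completeSpace_coe
  let ℓ : StrongDual 𝕜 (opAdj 𝕜 c).range :=
    ((innerSL 𝕜 h).comp (EnergySpace.incl 𝕜)).comp (e.symm : _ →L[𝕜] EnergySpace 𝕜)
  refine ⟨((InnerProductSpace.toDual 𝕜 _).symm ℓ : (opAdj 𝕜 c).range), fun g => ?_⟩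
  have h1 := InnerProductSpace.toDual_symm_apply (𝕜 := 𝕜) (x := e g) (y := ℓ)
  have h2 : ℓ (e g) = inner 𝕜 h (EnergySpace.incl 𝕜 g) := by
    change inner 𝕜 h (EnergySpace.incl 𝕜 (e.symm (e g))) = _
    rw [e.symm_apply_apply]
  rw [← h2, ← h1]
  rfl

theorem inner_mulKink (c : ℝ) (u v : L2 𝕜) :
    inner 𝕜 (mulKink 𝕜 c u) v = inner 𝕜 u (mulKink 𝕜 c v) := by
  rw [L2.inner_def, L2.inner_def]
  refine integral_congr_ae ?_
  filter_upwards [(memLp_kink_mul 𝕜 c u).coeFn_toLp, (memLp_kink_mul 𝕜 c v).coeFn_toLp]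
    with p h1 h2
  change inner 𝕜 ((memLp_kink_mul 𝕜 c u).toLp _ p) (v p) =
    inner 𝕜 (u p) ((memLp_kink_mul 𝕜 c v).toLp _ p)
  rw [h1, h2]
  simp only [RCLike.inner_apply, map_mul, RCLike.conj_ofReal]
  ring

/-- The adjoint of `opAdj` with domain `𝓔` is `𝓛_c` with domain `𝓔`. -/
theorem exists_opL_eq_of_weak (c : ℝ) {u h : L2 𝕜}
    (H : ∀ g, RCLike.re (inner 𝕜 u (opAdj 𝕜 c g)) =
      RCLike.re (inner 𝕜 h (EnergySpace.incl 𝕜 g))) :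
    ∃ U : EnergySpace 𝕜, EnergySpace.incl 𝕜 U = u ∧ opL 𝕜 c U = h := by
  -- Multiplication by `Q_c` is bounded and symmetric on `L²`, so that term moves to the data and
  -- leaves a constant-coefficient problem.
  obtain ⟨U, hU, hw⟩ := exists_energy_of_weak (u := u) (w := h + (2 : 𝕜) • mulKink 𝕜 c u)
    fun g => by
      have h1 := H g
      rw [opAdj_apply, inner_sub_right, map_sub, inner_smul_right] at h1
      rw [inner_add_left, map_add, inner_smul_left, inner_mulKink, ← h1]
      simp
  refine ⟨U, hU, ?_⟩
  rw [opL_apply, hw, hU, add_sub_cancel_right]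

theorem surjective_opL {c : ℝ} (hc : 0 < c) : Function.Surjective (opL 𝕜 c) := fun h => by
  obtain ⟨u, hu⟩ := exists_inner_opAdj_eq hc h
  obtain ⟨U, -, hU⟩ := exists_opL_eq_of_weak c fun g => congrArg RCLike.re (hu g)
  exact ⟨U, hU⟩

end Adjoint

section Kernel

theorem toComplex_solitonL2 {c : ℝ} (hc : 0 < c) :
    toComplex (solitonL2 𝕜 hc) = liftMode 0 (lineSoliton hc) := by
  refine Lp.ext ?_
  have h3 : ∀ᵐ p : ℝ × Torus, lineSoliton hc p.1 = (soliton c p.1 : ℂ) :=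
    Measure.quasiMeasurePreserving_fst.ae (memLp_soliton_complex hc).coeFn_toLp
  filter_upwards [(memLp_toComplexFun (solitonL2 𝕜 hc)).coeFn_toLp,
    (memLp_lift 𝕜 (memLp_soliton hc)).coeFn_toLp,
    (memLp_mul_fourier 0 (lineSoliton hc)).coeFn_toLp, h3] with p h1 h2 h3 h4
  rw [toComplex, h1, toComplexFun, solitonL2, h2, liftMode, h3, h4, fourier_zero, mul_one]
  simp

theorem mode_solitonL2 {c : ℝ} (hc : 0 < c) (n : ℤ) :
    mode (solitonL2 𝕜 hc) n = if n = 0 then lineSoliton hc else 0 := by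
  rw [← mode_toComplex, toComplex_solitonL2, mode_liftMode]

theorem solitonL2_ne_zero {c : ℝ} (hc : 0 < c) : solitonL2 𝕜 hc ≠ 0 := by
  intro h
  have h1 := (memLp_lift 𝕜 (memLp_soliton hc)).coeFn_toLp
  change solitonL2 𝕜 hc =ᵐ[volume] _ at h1
  rw [h] at h1
  obtain ⟨p, h2, h3⟩ := (h1.and (Lp.coeFn_zero 𝕜 2 (volume : Measure (ℝ × Torus)))).exists
  rw [h3, Pi.zero_apply] at h2
  exact (soliton_pos hc p.1).ne' (RCLike.ofReal_eq_zero.1 h2.symm)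

/-- Orthogonality of `φ_c` to the range of `opAdj` says weakly that `𝓛_c φ_c = 0`; the regularity
result then also gives `φ_c ∈ 𝓔`, without computing its Fourier transform. -/
theorem exists_soliton_mem_ker {c : ℝ} (hc : 0 < c) :
    ∃ s : EnergySpace 𝕜, EnergySpace.incl 𝕜 s = solitonL2 𝕜 hc ∧ opL 𝕜 c s = 0 := by
  refine exists_opL_eq_of_weak c fun g => ?_
  rw [inner_zero_left, map_zero]
  refine (hasSum_re_inner_mode (solitonL2 𝕜 hc) (opAdj 𝕜 c g)).unique ?_
  have he : (fun n => 2 * Real.pi *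
      (inner ℂ (mode (solitonL2 𝕜 hc) n) (mode (opAdj 𝕜 c g) n)).re) = fun _ => 0 := by
    funext n
    rw [mode_solitonL2]
    split_ifs with hn
    · subst hn
      rw [mode_opAdj, (isDerivInv_mode g 0).eq_zero, add_zero,
        (isDeriv_mode g 0).inner_lineSoliton hc]
      simp
    · simp
  rw [he]
  exact hasSum_zero

theorem exists_smul_solitonL2_of_opL_eq_zero {c : ℝ} (hc : 0 < c) {g : EnergySpace 𝕜}
    (hg : opL 𝕜 c g = 0) : ∃ t : 𝕜, EnergySpace.incl 𝕜 g = t • solitonL2 𝕜 hc := by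
  have hmode : ∀ n, -mode (EnergySpace.dx 𝕜 g) n + mode (EnergySpace.dxInvDy 𝕜 g) n -
      (2 : ℂ) • lineKink c (mode (EnergySpace.incl 𝕜 g) n) = 0 := fun n => by
    rw [← mode_opL, hg]
    exact map_zero (modeHom n)
  have h0 := hmode 0
  rw [(isDerivInv_mode g 0).eq_zero, add_zero, sub_eq_zero] at h0
  obtain ⟨z, hz⟩ := (isDeriv_mode g 0).eq_smul_lineSoliton hc (by rw [← h0, neg_neg])
  have h1 : toComplex (EnergySpace.incl 𝕜 g) = z • toComplex (solitonL2 𝕜 hc) := by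
    refine ext_mode fun n => ?_
    rw [mode_toComplex, mode_smul, mode_toComplex, map_complex_self, mode_solitonL2]
    split_ifs with hn
    · subst hn; exact hz
    · rw [smul_zero]
      exact mode_eq_zero_of_ne_zero hc hn (isDeriv_mode g n) (isDerivInv_mode g n) (hmode n)
  -- The coefficient found over `ℂ` is projected to `𝕜`; since `φ_c` is real, this commutes with
  -- projecting `z φ_c`.
  refine ⟨RCLike.map ℂ 𝕜 z, ?_⟩
  rw [← ofComplex_toComplex (EnergySpace.incl 𝕜 g), h1]
  refine Lp.ext ?_
  filter_upwards [(memLp_map_complex (𝕜 := 𝕜) (z • toComplex (solitonL2 𝕜 hc))).coeFn_toLp,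
    Lp.coeFn_smul z (toComplex (solitonL2 𝕜 hc)),
    Lp.coeFn_smul (RCLike.map ℂ 𝕜 z) (solitonL2 𝕜 hc),
    (memLp_toComplexFun (solitonL2 𝕜 hc)).coeFn_toLp,
    (memLp_lift 𝕜 (memLp_soliton hc)).coeFn_toLp] with p e1 e2 e3 e4 e5
  have e5' : solitonL2 𝕜 hc p = ((soliton c p.1 : ℝ) : 𝕜) := e5
  rw [ofComplex, e1, e2, e3, Pi.smul_apply, Pi.smul_apply, toComplex, e4, toComplexFun, e5',
    RCLike.map_apply, RCLike.map_apply, RCLike.map_apply]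
  simp
  ring

end Kernel

/-! ### The kernel as a line in `𝓔` and its orthogonal complement. -/

section Fredholm

theorem injective_incl : Function.Injective (EnergySpace.incl 𝕜) := Subtype.val_injective

theorem ker_opL {c : ℝ} (hc : 0 < c) {s : EnergySpace 𝕜}
    (hs : EnergySpace.incl 𝕜 s = solitonL2 𝕜 hc) (hs' : opL 𝕜 c s = 0) :
    (opL 𝕜 c).ker = Submodule.span 𝕜 {s} := by
  refine le_antisymm (fun g hg => ?_) ?_
  · obtain ⟨t, ht⟩ := exists_smul_solitonL2_of_opL_eq_zero hc (LinearMap.mem_ker.1 hg)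
    refine Submodule.mem_span_singleton.2 ⟨t, injective_incl ?_⟩
    rw [map_smul, hs, ht]
  · rw [Submodule.span_singleton_le_iff_mem]
    exact LinearMap.mem_ker.2 hs'

theorem kinkDerivL2_eq {c : ℝ} (hc : 0 < c) :
    kinkDerivL2 𝕜 hc = ((1 / 2 : ℝ) : 𝕜) • solitonL2 𝕜 hc := by
  refine Lp.ext ?_
  filter_upwards [(memLp_lift 𝕜 (memLp_deriv_kink hc)).coeFn_toLp,
    (memLp_lift 𝕜 (memLp_soliton hc)).coeFn_toLp,
    Lp.coeFn_smul ((1 / 2 : ℝ) : 𝕜) (solitonL2 𝕜 hc)] with p h1 h2 h3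
  rw [h3, Pi.smul_apply, solitonL2, h2, kinkDerivL2, h1, deriv_kink hc, smul_eq_mul]
  push_cast
  ring

theorem mem_energyPerp {c : ℝ} (hc : 0 < c) (g : EnergySpace 𝕜) :
    g ∈ energyPerp 𝕜 hc ↔ inner 𝕜 (solitonL2 𝕜 hc) (EnergySpace.incl 𝕜 g) = 0 := by
  rw [energyPerp, Submodule.mem_comap, Submodule.mem_orthogonal_singleton_iff_inner_right,
    kinkDerivL2_eq, inner_smul_left]
  simp

theorem isClosed_energyPerp {c : ℝ} (hc : 0 < c) :
    IsClosed (energyPerp 𝕜 hc : Set (EnergySpace 𝕜)) :=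
  (Submodule.isClosed_orthogonal _).preimage (EnergySpace.incl 𝕜).continuous

end Fredholm

end LinearizedOperator

end LineSoliton

end

theorem lemma3p3 (𝕜 : Type*) [RCLike 𝕜] (c : ℝ) (hc : 0 < c) :
    (LineSoliton.opL 𝕜 c).IsFredholm ∧
    (LineSoliton.opL 𝕜 c).ker.map (LineSoliton.EnergySpace.incl 𝕜).toLinearMap =
      Submodule.span 𝕜 {LineSoliton.solitonL2 𝕜 hc} ∧
    (LineSoliton.opL 𝕜 c).range = ⊤ ∧
    ∃ e : LineSoliton.energyPerp 𝕜 hc ≃L[𝕜] LineSoliton.L2 𝕜,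
      ∀ u : LineSoliton.energyPerp 𝕜 hc, e u = LineSoliton.opL 𝕜 c u := by
  open LineSoliton in
  obtain ⟨s, hs, hs'⟩ := exists_soliton_mem_ker (𝕜 := 𝕜) hc
  have hker := ker_opL hc hs hs'
  have hsurj := surjective_opL (𝕜 := 𝕜) hc
  have hrange : (opL 𝕜 c).range = ⊤ := LinearMap.range_eq_top.2 hsurj
  have hss : inner 𝕜 (solitonL2 𝕜 hc) (solitonL2 𝕜 hc) ≠ 0 :=
    inner_self_ne_zero.2 (solitonL2_ne_zero hc)
  have hfin : FiniteDimensional 𝕜 (opL 𝕜 c).ker := by rw [hker]; infer_instance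
  refine ⟨⟨((opL 𝕜 c).isOpenMap hsurj).isStrictMap (opL 𝕜 c).continuous, ?_, hfin, ?_,
    Submodule.ClosedComplemented.of_finiteDimensional _⟩, ?_, hrange, ?_⟩
  · rw [hrange]; exact isClosed_univ
  · rw [hrange]; exact Submodule.CoFG.top
  · rw [hker, Submodule.map_span, Set.image_singleton]
    congr 2
  · have : CompleteSpace (energyPerp 𝕜 hc) := (isClosed_energyPerp hc).completeSpace_coe
    refine ⟨ContinuousLinearEquiv.ofBijective ((opL 𝕜 c).comp (energyPerp 𝕜 hc).subtypeL) ?_ ?_,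
      fun u => rfl⟩
    · refine LinearMap.ker_eq_bot'.2 fun g hg => ?_
      obtain ⟨t, ht⟩ := exists_smul_solitonL2_of_opL_eq_zero (g := (g : EnergySpace 𝕜)) hc hg
      have hperp := (mem_energyPerp hc _).1 g.2
      rw [ht, inner_smul_right, mul_eq_zero] at hperp
      rw [hperp.resolve_right hss, zero_smul] at ht
      exact Subtype.ext (injective_incl (ht.trans (map_zero (EnergySpace.incl 𝕜)).symm))
    · refine LinearMap.range_eq_top.2 fun h => ?_
      obtain ⟨U, hU⟩ := hsurj h
      -- Coefficient of the `L²`-orthogonal projection on `φ_c`; subtracting this kernel element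
      -- does not change the image.
      let t := inner 𝕜 (solitonL2 𝕜 hc) (EnergySpace.incl 𝕜 U) /
        inner 𝕜 (solitonL2 𝕜 hc) (solitonL2 𝕜 hc)
      have hmem : U - t • s ∈ energyPerp 𝕜 hc := by
        rw [mem_energyPerp, map_sub, map_smul, hs, inner_sub_right, inner_smul_right,
          div_mul_cancel₀ _ hss, sub_self]
      refine ⟨⟨U - t • s, hmem⟩, ?_⟩
      change opL 𝕜 c (U - t • s) = h
      rw [map_sub, map_smul, hs', smul_zero, sub_zero, hU]
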